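/- Let $M$ be a two-dimensional smooth manifold (connected, Hausdorff, second countable), $\tau:TM\to M$ its tangent bundle, $\mathring TM$ the set of nonzero tangent vectors. Sections along $\mathring\tau:\mathring TM\to M$ are smooth maps $\widetilde X:\mathring TM\to TM$ with $\tau\circ\widetilde X=\mathring\tau$; $\delta(u)=u$ is the canonical section; $\hat X=X\circ\mathring\tau$ for a vector field $X$ on $M$. Let $\mathbf i$ be the vertical lift of such sections to vertical vector fields on $\mathring TM$, $\mathbf j$ the map induced by $\tau_*$, $\mathbf J=\mathbf i\circ\mathbf j$, and $\nabla^{\mathsf v}f(\widetilde X)=(\mathbf i\widetilde X)f$; extend $\nabla^{\mathsf v}$ to tensors along $\mathring\tau$ so that $\nabla^{\mathsf v}\hat X=0$ for all $X$. Let $F:TM\to\mathbb R$ be a Finsler function: smooth on $\mathring TM$, $F(\lambda v)=\lambda F(v)$ for $\lambda\ge 0$, and with non-degenerate metric tensor $g=\frac12\nabla^{\mathsf v}\nabla^{\mathsf v}F^2$ on $\mathring TM$. With $E=\frac12F^2$, the canonical spray $S$ is the vector field, zero on the zero section and smooth on $\mathring TM$, with $i_S\,d(dE\circ\mathbf J)=-dE$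 on $\mathring TM$. Its connection $\mathcal H$ is the fibrewise linear map given by $\mathcal H(\hat X)=\frac12(X^{\mathsf c}+[\mathbf i\hat X,S])$, $X^{\mathsf c}$ being the complete lift of the vector field $X$ on $M$, and $\mathcal V=\mathbf i^{-1}\circ(1-\mathcal H\circ\mathbf j)$. Put $$\mathbf K(\widetilde X)=\mathcal V[S,\mathcal H\widetilde X],\qquad \mathbf R(\widetilde X,\widetilde Y)=-\mathcal V[\mathcal H\widetilde X,\mathcal H\widetilde Y]$$ (Jacobi endomorphism and curvature), and, with $n=\dim M=2$, define the Weyl endomorphism by $$\mathbf W^\circ=\mathbf K-\tfrac1{n-1}(\operatorname{tr}\mathbf K)\mathbf 1+\tfrac3{n+1}(\operatorname{tr}\mathbf R)\otimes\delta+\tfrac{2-n}{n^2-1}(\nabla^{\mathsf v}\operatorname{tr}\mathbf K)\otimes\delta,$$ where $(\operatorname{tr}\mathbf R)(\widetilde X)=\operatorname{tr}(\widetilde Z\mapsto\mathbf R(\widetilde Z,\widetilde X))$. (1) Suppose that $(M,F)$ is positive definite, i.e. $F>0$ on $\mathring TM$. A Berwald frame on an open set $U\subseteq\mathring TM$ is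 a pair $(\ell,m)$, where $\ell=\frac1F\delta$ and $m$ is a section along $\mathring\tau$ over $U$ with $g(\ell,m)=0$, $g(m,m)=1$. Berwald frames exist around every point of $\mathring TM$, and $\kappa:=g(\mathbf R(m,\ell),m)$ (the Gauss curvature) does not depend on the choice of the frame, so it is a function on $\mathring TM$. The Jacobi endomorphism is $$\mathbf K=\kappa F\,\mathbf 1-\kappa\,\nabla^{\mathsf v}F\otimes\delta .$$ (2) Every two-dimensional Finsler manifold $(M,F)$ is isotropic: there are a smooth function $\lambda$ on $\mathring TM$ and a smooth one-form $\widetilde\alpha$ along $\mathring\tau$ with $\mathbf K=\lambda\mathbf 1+\widetilde\alpha\otimes\delta$. (3) The Weyl endomorphism of every two-dimensional Finsler manifold vanishes: $\mathbf W^\circ=0$. -/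

import Mathlib

open Set Module
open scoped Manifold ContDiff

noncomputable section

namespace Finsler

variable (E : Type*) [NormedAddCommGroup E] [NormedSpace ℝ E]
  (M : Type*) [TopologicalSpace M] [ChartedSpace E M] [IsManifold 𝓘(ℝ, E) ∞ M]

/-- The tangent manifold `TM` of a manifold `M` modelled on `E`; a point `u` of `TM` has the
base point `u.proj` and is the vector `u.2` of the tangent space at `u.proj`. -/
abbrev TM : Type _ := TangentBundle 𝓘(ℝ, E) M

/-- The model with corners of `TM`. -/
abbrev modelTM : ModelWithCorners ℝ (E × E) (ModelProd E E) := (𝓘(ℝ, E)).tangent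

/-- The slit tangent bundle, as an open subset of `TM`: the nonzero tangent vectors. -/
def slit : Set (TM E M) := {u | u.2 ≠ 0}

variable {E M}

/-! ### Vector fields and sections of the pull-back bundle

Vector fields on the slit tangent bundle and sections along its projection to `M` are written as
functions on all of `TM`; their values on the zero section are irrelevant, and smoothness is asked
for on the slit tangent bundle only. -/

variable (E M) in
/-- (Rough) vector fields on `TM`. -/
abbrev VF : Type _ := ∀ u : TM E M, TangentSpace (modelTM E) u

variable (E M) in
/-- (Rough) sections of the pull-back bundle: `X u` is a tangent vector of `M` at the base point
of `u`. -/
abbrev Sec : Type _ := ∀ u : TM E M, TangentSpace 𝓘(ℝ, E) u.proj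

/-- Smoothness on a set `U ⊆ TM` of a function on `TM`. -/
def SmoothFun (U : Set (TM E M)) (f : TM E M → ℝ) : Prop :=
  ContMDiffOn (modelTM E) 𝓘(ℝ, ℝ) ∞ f U

/-- Smoothness on a set `U ⊆ TM` of a vector field on `TM`. -/
def SmoothVF (U : Set (TM E M)) (ξ : VF E M) : Prop :=
  ContMDiffOn (modelTM E) (modelTM E).tangent ∞
    (fun u => (⟨u, ξ u⟩ : TangentBundle (modelTM E) (TM E M))) U

/-- Smoothness on a set `U ⊆ TM` of a section of the pull-back bundle. -/
def SmoothSec (U : Set (TM E M)) (X : Sec E M) : Prop :=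
  ContMDiffOn (modelTM E) (modelTM E) ∞ (fun u => (⟨u.proj, X u⟩ : TM E M)) U

/-- Smooth vector fields on the base manifold. -/
def SmoothBaseVF (X : ∀ p : M, TangentSpace 𝓘(ℝ, E) p) : Prop :=
  ContMDiff 𝓘(ℝ, E) (modelTM E) ∞ (fun p => (⟨p, X p⟩ : TM E M))

/-- The canonical section `δ : u ↦ (u, u)`. -/
def delta : Sec E M := fun u => u.2

/-- The basic section `X̂ : u ↦ (u, X (τ u))` of a vector field `X` on `M`. -/
def basic (X : ∀ p : M, TangentSpace 𝓘(ℝ, E) p) : Sec E M := fun u => X u.proj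

/-- The differential at `u` of a function on `TM`. -/
def dTM (f : TM E M → ℝ) (u : TM E M) : TangentSpace (modelTM E) u →L[ℝ] ℝ :=
  mfderiv (modelTM E) 𝓘(ℝ, ℝ) f u

/-- The Lie bracket of vector fields on `TM`. -/
def bracket (ξ η : VF E M) : VF E M := VectorField.mlieBracket (modelTM E) ξ η

/-! ### The canonical bundle maps -/

/-- The inclusion `w ↦ w` of the tangent space at `p` into `TM`; this tangent space is, by
definition, a copy of the vector space `E`. -/
def fibreIncl (p : M) (w : E) : TM E M := ⟨p, w⟩

/-- The vector `u.2` tangent at `u.proj`, as an element of this copy of `E`. -/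
def fibreVec (u : TM E M) : E := u.2

/-- The vertical lift `i`: `iMap u w` is the velocity at `t = 0` of `t ↦ u + t w`, that is, the
derivative at `u` in the direction `w` of the inclusion of the fibre through `u`. -/
def iMap (u : TM E M) : TangentSpace 𝓘(ℝ, E) u.proj →L[ℝ] TangentSpace (modelTM E) u :=
  mfderiv 𝓘(ℝ, E) (modelTM E) (fibreIncl u.proj) (fibreVec u)

/-- The map `j`: the derivative of the projection `τ : TM → M`. -/
def jMap (u : TM E M) : TangentSpace (modelTM E) u →L[ℝ] TangentSpace 𝓘(ℝ, E) u.proj :=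
  mfderiv (modelTM E) 𝓘(ℝ, E) (fun v : TM E M => v.proj) u

/-- `i` on sections. -/
def iSec (X : Sec E M) : VF E M := fun u => iMap u (X u)

/-- The vertical endomorphism `J = i ∘ j` on vector fields. -/
def vertEnd (ξ : VF E M) : VF E M := fun u => iMap u (jMap u (ξ u))

/-- The complete lift `X^c` of a vector field `X` on `M`: the vector field on `TM` that is
`τ`-related to `X` and satisfies `X^c f^c = (X f)^c` for all smooth `f` on `M`, where
`f^c u = u f`. (Off the zero section the second property alone determines `X^c` pointwise; on the
zero section the first one has to be mentioned.) -/
def completeLift (X : ∀ p : M, TangentSpace 𝓘(ℝ, E) p) : VF E M := fun u =>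
  Classical.epsilon fun ξ : TangentSpace (modelTM E) u =>
    jMap u ξ = X u.proj ∧
    ∀ f : M → ℝ, ContMDiff 𝓘(ℝ, E) 𝓘(ℝ, ℝ) ∞ f →
      dTM (fun v : TM E M => (mfderiv 𝓘(ℝ, E) 𝓘(ℝ, ℝ) f v.proj v.2 : ℝ)) u ξ =
        (mfderiv 𝓘(ℝ, E) 𝓘(ℝ, ℝ)
          (fun p : M => (mfderiv 𝓘(ℝ, E) 𝓘(ℝ, ℝ) f p (X p) : ℝ)) u.proj u.2 : ℝ)

/-! ### Tensors along the projection -/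

/-- The vertical differential `∇^v f` of a function on `TM`, `∇^v f (X) = (i X) f`. -/
def vDiff (f : TM E M → ℝ) (u : TM E M) : TangentSpace 𝓘(ℝ, E) u.proj →L[ℝ] ℝ :=
  (dTM f u).comp (iMap u)

/-- Smooth one-forms along the projection of the slit tangent bundle. -/
def SmoothOneForm (α : ∀ u : TM E M, TangentSpace 𝓘(ℝ, E) u.proj →ₗ[ℝ] ℝ) : Prop :=
  ∀ X : Sec E M, SmoothSec (slit E M) X → SmoothFun (slit E M) (fun u => α u (X u))

/-- The value at `u` of a type (1,1) tensor `A` that is given as a (function-linear) operator on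
sections: the endomorphism `a` of the fibre over `u` with `A(X)(u) = a (X u)` for all `X`. -/
def valueAt (A : Sec E M → Sec E M) (u : TM E M) :
    TangentSpace 𝓘(ℝ, E) u.proj →ₗ[ℝ] TangentSpace 𝓘(ℝ, E) u.proj :=
  Classical.epsilon fun a => ∀ X : Sec E M, SmoothSec (slit E M) X → A X u = a (X u)

/-- The trace of a type (1,1) tensor along the projection. -/
def tr (A : Sec E M → Sec E M) : TM E M → ℝ := fun u =>
  LinearMap.trace ℝ (TangentSpace 𝓘(ℝ, E) u.proj) (valueAt A u)

/-! ### The geometry of a spray `S` -/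

/-- The Ehresmann connection `H` generated by `S`: at `u` it is the linear map `h` with
`h (X̂ u) = ½ (X^c + [X^v, S]) u` for all vector fields `X` on `M`, where `X^v = i X̂`. -/
def connection (S : VF E M) (u : TM E M) :
    TangentSpace 𝓘(ℝ, E) u.proj →ₗ[ℝ] TangentSpace (modelTM E) u :=
  Classical.epsilon fun h => ∀ X : (∀ p : M, TangentSpace 𝓘(ℝ, E) p), SmoothBaseVF X →
    h (basic X u) = (1 / 2 : ℝ) • (completeLift X u + bracket (iSec (basic X)) S u)

/-- The connection on sections. -/
def horSec (S : VF E M) (X : Sec E M) : VF E M := fun u => connection S u (X u)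

/-- The vertical map `V = i⁻¹ ∘ v`, where `v ξ = ξ - H (j ξ)` is the vertical part of `ξ`. -/
def vertSec (S : VF E M) (ξ : VF E M) : Sec E M := fun u =>
  Classical.epsilon fun w : TangentSpace 𝓘(ℝ, E) u.proj =>
    iMap u w = ξ u - connection S u (jMap u (ξ u))

/-- The Jacobi endomorphism `K(X) = V [S, H X]`. -/
def jacobi (S : VF E M) (X : Sec E M) : Sec E M := vertSec S (bracket S (horSec S X))

/-- The curvature `R(X, Y) = - V [H X, H Y]` of the connection. -/
def curvature (S : VF E M) (X Y : Sec E M) : Sec E M :=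
  -vertSec S (bracket (horSec S X) (horSec S Y))

/-- `S` is isotropic: `K = λ 1 + α ⊗ δ` on the slit tangent bundle, with a smooth function `λ`
and a smooth one-form `α` along the projection. -/
def IsIsotropic (S : VF E M) : Prop :=
  ∃ (lam : TM E M → ℝ) (α : ∀ u : TM E M, TangentSpace 𝓘(ℝ, E) u.proj →ₗ[ℝ] ℝ),
    SmoothFun (slit E M) lam ∧ SmoothOneForm α ∧
    ∀ X : Sec E M, SmoothSec (slit E M) X → ∀ u ∈ slit E M,
      jacobi S X u = lam u • X u + α u (X u) • delta u

/-- The Weyl endomorphism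
`W = K - (tr K)/(n-1) 1 + 3/(n+1) (tr R) ⊗ δ + (2-n)/(n²-1) (∇^v tr K) ⊗ δ`, `n = dim M`, where
`(tr R)(X)` is the trace of `Z ↦ R(Z, X)`. -/
def weyl (S : VF E M) (X : Sec E M) : Sec E M := fun u =>
  let n : ℝ := finrank ℝ E
  jacobi S X u - (1 / (n - 1) * tr (jacobi S) u) • X u
    + (3 / (n + 1) * tr (fun Z => curvature S Z X) u) • delta u
    + ((2 - n) / (n ^ 2 - 1) * vDiff (tr (jacobi S)) u (X u)) • delta u

/-! ### Finsler functions -/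

/-- The metric tensor `g = ½ ∇^v ∇^v F²`. (The vertical derivative of a one-form along the
projection is taken in the fibres, where vectors constant along the fibre are parallel.) -/
def metric (F : TM E M → ℝ) (u : TM E M) (w z : TangentSpace 𝓘(ℝ, E) u.proj) : ℝ :=
  (1 / 2 : ℝ) *
    fderiv ℝ (fun y : E => vDiff (fun v => F v ^ 2) (fibreIncl u.proj y) z) (fibreVec u) w

/-- Finsler functions: smooth off the zero section, positive-homogeneous of degree one, with
fibrewise non-degenerate metric tensor. -/
structure IsFinslerFunction (F : TM E M → ℝ) : Prop where
  smooth : SmoothFun (slit E M) F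
  homogeneous : ∀ (p : M) (w : TangentSpace 𝓘(ℝ, E) p) (c : ℝ), 0 ≤ c →
    F ⟨p, c • w⟩ = c * F ⟨p, w⟩
  nondegenerate : ∀ u ∈ slit E M, ∀ w : TangentSpace 𝓘(ℝ, E) u.proj,
    (∀ z, metric F u w z = 0) → w = 0

/-- Positive definiteness of a Finsler function: it is positive off the zero section. -/
def IsPositiveDefinite (F : TM E M → ℝ) : Prop := ∀ u ∈ slit E M, 0 < F u

/-- The energy function `½ F²`. -/
def energy (F : TM E M → ℝ) : TM E M → ℝ := fun u => (1 / 2 : ℝ) * F u ^ 2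

/-- The one-form `d_J f = df ∘ J`, on vector fields. -/
def dJ (f : TM E M → ℝ) (ξ : VF E M) : TM E M → ℝ := fun u => dTM f u (vertEnd ξ u)

/-- The two-form `d d_J f`, on vector fields:
`dθ(ξ, η) = ξ (θ η) - η (θ ξ) - θ [ξ, η]` with `θ = d_J f`. -/
def ddJ (f : TM E M → ℝ) (ξ η : VF E M) : TM E M → ℝ := fun u =>
  dTM (dJ f η) u (ξ u) - dTM (dJ f ξ) u (η u) - dJ f (bracket ξ η) u

/-- The canonical spray of a Finsler function: the vector field `S` that vanishes on the zero
section, is smooth off it, and satisfies `i_S d d_J E = -dE` there, `E` being the energy. -/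
def canonicalSpray (F : TM E M → ℝ) : VF E M :=
  Classical.epsilon fun S : VF E M =>
    (∀ u, u ∉ slit E M → S u = 0) ∧ SmoothVF (slit E M) S ∧
    ∀ ξ : VF E M, SmoothVF (slit E M) ξ → ∀ u ∈ slit E M,
      ddJ (energy F) S ξ u = -dTM (energy F) u (ξ u)

/-- The normalized support element field `ℓ = (1/F) δ`. -/
def supportElement (F : TM E M → ℝ) : Sec E M := fun u => (F u)⁻¹ • delta u

/-- `(ℓ, m)` is a Berwald frame over the open subset `U` of the slit tangent bundle. -/
structure IsBerwaldFrame (F : TM E M → ℝ) (U : Set (TM E M)) (m : Sec E M) : Prop where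
  isOpen : IsOpen U
  subset : U ⊆ slit E M
  smooth : SmoothSec U m
  orthogonal : ∀ u ∈ U, metric F u (supportElement F u) (m u) = 0
  unit : ∀ u ∈ U, metric F u (m u) (m u) = 1

/-- The component `g(R(m, ℓ), m)` of the curvature of the canonical connection. -/
def frameCurvature (F : TM E M → ℝ) (m : Sec E M) : TM E M → ℝ := fun u =>
  metric F u (curvature (canonicalSpray F) m (supportElement F) u) (m u)

/-- The Gauss curvature `κ = g(R(m, ℓ), m)` of a two-dimensional positive definite Finsler
manifold, where `(ℓ, m)` is any Berwald frame around `u`. -/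
def gaussCurvature (F : TM E M → ℝ) : TM E M → ℝ := fun u =>
  Classical.epsilon fun k : ℝ => ∃ (U : Set (TM E M)) (m : Sec E M),
    IsBerwaldFrame F U m ∧ u ∈ U ∧ k = frameCurvature F m u

end Finsler

end

/-! The proof rests on plane linear algebra. A skew bilinear map `R` on a plane has the form `ω ⊗ v`
with `ω` an area form, and the vanishing of three-forms in dimension two gives `R(a, b) = tr R(·, b)
a - tr R(·, a) b` (`two_dim_identity`). If `S` is homogeneous of degree two then `S = H δ`, so `K(X)
= V[H δ, H X] = R(X, δ)`. Putting `b = δ` yields `K = (tr K) 1 - (tr R) ⊗ δ` (`IsSpray.jacobi_eq`).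
This is isotropy; and since the coefficients of the Weyl endomorphism become 1, 1 and 0 for `n = 2`,
it is also the vanishing of `W`. No Finsler function enters here beyond the fact that its canonical
field is a spray (`IsFinslerFunction.isSpray`).

The metric is needed for the Gauss curvature. The energy is constant along `S`; a fibre derivative
of this shows that it is annihilated by all horizontal vectors (`fderiv_hor`), hence by the vertical
parts of their brackets, that is, by the values of `R` (`fderiv_flatCurv`). Applying `dE` to the
plane identity, with Euler's relation `dE(i δ) = 2E = F²`, gives `tr R = (tr K / F) ∇^v F`. Pairing
the same identity with `m` gives `g(R(m, ℓ), m) = tr K / F` in every Berwald frame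
(`frameCurvature_eq`), so `κ F = tr K`.

Berwald frames need a vector orthogonal to `δ` on which `g` is positive, while only `F > 0` is
given. Such a normal is never null, since `g` is non-degenerate; it is positive at a minimum of the
energy on a Euclidean unit circle of the fibre, hence everywhere, the punctured plane being
connected (`flatMetric_flatNormal_pos`).

The geometric objects are computed in the charts of `TM` induced by those of `M`. As many of them
are chosen by `Classical.epsilon`, the chart formulas must also show that an object with the
required property exists and that the property determines it. -/

noncomputable section
open Filter Topology

namespace Finsler

/-! ### Induced charts of `TM`; smoothness and differentials in them -/

section Charts
variable {E : Type*} [NormedAddCommGroup E] [NormedSpace ℝ E]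
  {M : Type*} [TopologicalSpace M] [ChartedSpace E M] [IsManifold 𝓘(ℝ, E) ∞ M]

variable (M) in
lemma isManifold_one : IsManifold 𝓘(ℝ, E) 1 M := IsManifold.of_le (n := ∞) (by norm_cast)

attribute [local instance] isManifold_one

variable (E) in
/-- The chart of `TM` induced by the preferred chart at `c`. -/
def chart (c : M) : PartialEquiv (TM E M) (E × E) := extChartAt (modelTM E) (⟨c, 0⟩ : TM E M)

/-- The derivative of the preferred chart at `c`. -/
def baseRep (c p : M) : TangentSpace 𝓘(ℝ, E) p →L[ℝ] E :=
  mfderiv 𝓘(ℝ, E) 𝓘(ℝ, E) (extChartAt 𝓘(ℝ, E) c) p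

/-- The derivative of the chart of `TM` induced by the preferred chart at `c`. -/
def tmRep (c : M) (u : TM E M) : TangentSpace (modelTM E) u →L[ℝ] E × E :=
  mfderiv (modelTM E) 𝓘(ℝ, E × E) (chart E c) u

lemma chart_source (c : M) : (chart E c).source =
    Bundle.TotalSpace.proj ⁻¹' (chartAt E c).source := by
  ext u
  rw [chart, extChartAt_source, TangentBundle.mem_chart_source_iff]
  rfl

lemma chart_target (c : M) : (chart E c).target =
    (extChartAt 𝓘(ℝ, E) c).target ×ˢ univ := by
  ext z
  have := TangentBundle.mem_chart_target_iff (I := 𝓘(ℝ, E)) (M := M) z ⟨c, 0⟩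
  rw [mem_prod]
  simp only [mem_univ, and_true, mfld_simps]
  refine Iff.trans ?_ this
  rw [chart, extChartAt_target]
  have hr : range (modelTM E) = univ := ModelWithCorners.range_eq_univ _
  rw [hr, inter_univ]
  rfl

/-- The fibre coordinate of the trivialization of the tangent bundle is the derivative of the base
chart. All later chart formulas go back to this. -/
lemma chart_apply {c : M} {u : TM E M} (h : u.proj ∈ (chartAt E c).source) :
    chart E c u = (extChartAt 𝓘(ℝ, E) c u.proj, baseRep c u.proj u.2) := by
  have h1 := TangentBundle.continuousLinearMapAt_trivializationAt (I := 𝓘(ℝ, E)) h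
  have h2 : baseRep c u.proj u.2 = (trivializationAt E (TangentSpace 𝓘(ℝ, E)) c).continuousLinearMapAt ℝ u.proj u.2 := by
    rw [h1]; rfl
  rw [h2, TangentBundle.continuousLinearMapAt_trivializationAt_eq_core h]
  rfl

lemma isInvertible_baseRep {c p : M} (h : p ∈ (chartAt E c).source) :
    (baseRep (E := E) c p).IsInvertible :=
  isInvertible_mfderiv_extChartAt (by rwa [extChartAt_source])

lemma isInvertible_tmRep {c : M} {u : TM E M} (h : u.proj ∈ (chartAt E c).source) :
    (tmRep c u).IsInvertible :=
  isInvertible_mfderiv_extChartAt (x := (⟨c, 0⟩ : TM E M)) (y := u)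
    (by have := chart_source (E := E) c; unfold chart at this; rw [this]; exact h)

/-- A map into the total space is smooth when its base part and its fibre coordinate are; the base
part is here the projection, which is always smooth. -/
lemma contMDiffAt_sec_iff {c : M} {u : TM E M} (h : u.proj ∈ (chartAt E c).source) (X : Sec E M) :
    ContMDiffAt (modelTM E) (modelTM E) ∞ (fun u => (⟨u.proj, X u⟩ : TM E M)) u ↔
    ContMDiffAt (modelTM E) 𝓘(ℝ, E) ∞ (fun u => baseRep c u.proj (X u)) u := by
  have h0 : ContMDiffAt (modelTM E) 𝓘(ℝ, E) ∞ (Bundle.TotalSpace.proj : TM E M → M) u :=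
    Bundle.contMDiffAt_proj _
  have := (trivializationAt E (TangentSpace 𝓘(ℝ, E)) c).contMDiffAt_iff (IB := 𝓘(ℝ, E)) (IM := modelTM E) (n := ∞) (f := fun u : TM E M => (⟨u.proj, X u⟩ : TM E M)) (x₀ := u)
     h
  refine this.trans ((and_iff_right h0).trans ?_)
  refine Filter.EventuallyEq.contMDiffAt_iff ?_
  have ho : Bundle.TotalSpace.proj ⁻¹' (chartAt E c).source ∈ 𝓝 u :=
    h0.continuousAt.preimage_mem_nhds ((chartAt E c).open_source.mem_nhds h)
  filter_upwards [ho] with v hv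
  have := chart_apply (c := c) (u := (⟨v.proj, X v⟩ : TM E M)) hv
  exact congrArg Prod.snd this

lemma contMDiffAt_vf_iff {c : M} {u : TM E M} (h : u.proj ∈ (chartAt E c).source) (ξ : VF E M) :
    ContMDiffAt (modelTM E) (modelTM E).tangent ∞
    (fun u => (⟨u, ξ u⟩ : TangentBundle (modelTM E) (TM E M))) u ↔
    ContMDiffAt (modelTM E) 𝓘(ℝ, E × E) ∞ (fun u => tmRep c u (ξ u)) u := by
  have hs : ∀ v : TM E M, v.proj ∈ (chartAt E c).source ↔ v ∈ (chartAt (ModelProd E E) (⟨c, 0⟩ : TM E M)).source := fun v =>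
    (TangentBundle.mem_chart_source_iff v (⟨c, 0⟩ : TM E M)).symm
  have := (trivializationAt (E × E) (TangentSpace (modelTM E)) (⟨c, 0⟩ : TM E M)).contMDiffAt_section_iff (IB := modelTM E) (n := ∞) (s := ξ) ((hs u).1 h)
  refine this.trans ?_
  refine Filter.EventuallyEq.contMDiffAt_iff ?_
  have ho : (chartAt (ModelProd E E) (⟨c, 0⟩ : TM E M)).source ∈ 𝓝 u :=
    (chartAt _ _).open_source.mem_nhds ((hs u).1 h)
  filter_upwards [ho] with v hv
  have h1 := TangentBundle.continuousLinearMapAt_trivializationAt (I := modelTM E) hv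
  have h2 : tmRep c v (ξ v) = (trivializationAt (E × E) (TangentSpace (modelTM E)) (⟨c, 0⟩ : TM E M)).continuousLinearMapAt ℝ v (ξ v) := by
    rw [h1]; rfl
  rw [h2, TangentBundle.continuousLinearMapAt_trivializationAt_eq_core hv]
  rfl

lemma contMDiffAt_iff_contDiffAt_chart {c : M} {u : TM E M} (h : u.proj ∈ (chartAt E c).source)
    {V : Type*} [NormedAddCommGroup V] [NormedSpace ℝ V] (f : TM E M → V) :
    ContMDiffAt (modelTM E) 𝓘(ℝ, V) ∞ f u ↔
      ContDiffAt ℝ ∞ (fun z => f ((chart E c).symm z)) (chart E c u) := by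
  have hu : u ∈ (chartAt (ModelProd E E) (⟨c, 0⟩ : TM E M)).source :=
    (TangentBundle.mem_chart_source_iff _ _).2 h
  rw [contMDiffAt_iff_source_of_mem_source hu]
  have hr : range (modelTM E) = univ := ModelWithCorners.range_eq_univ _
  rw [hr, contMDiffWithinAt_univ, contMDiffAt_iff_contDiffAt]
  rfl

lemma isOpen_chart_source (c : M) : IsOpen (chart E c).source := isOpen_extChartAt_source _

lemma isOpen_chart_target (c : M) : IsOpen (chart E c).target := isOpen_extChartAt_target _

lemma continuousAt_chart_symm {c : M} {z : E × E} (hz : z ∈ (chart E c).target) :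
    ContinuousAt (chart E c).symm z := continuousAt_extChartAt_symm'' hz

lemma continuousAt_chart {c : M} {u : TM E M} (h : u.proj ∈ (chartAt E c).source) :
    ContinuousAt (chart E c) u := continuousAt_extChartAt' (by
      have := chart_source (E := E) c; unfold chart at this; rw [this]; exact h)

lemma mdifferentiableAt_chart {c : M} {u : TM E M} (h : u.proj ∈ (chartAt E c).source) :
    MDifferentiableAt (modelTM E) 𝓘(ℝ, E × E) (chart E c) u :=
  mdifferentiableAt_extChartAt ((TangentBundle.mem_chart_source_iff _ _).2 h)

lemma contMDiffAt_chart_symm {c : M} {z : E × E} (hz : z ∈ (chart E c).target) :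
    ContMDiffAt 𝓘(ℝ, E × E) (modelTM E) ∞ (chart E c).symm z :=
  (contMDiffOn_extChartAt_symm (⟨c, 0⟩ : TM E M)).contMDiffAt ((isOpen_chart_target c).mem_nhds hz)

/-- The local representative of a section. -/
def secRep (c : M) (X : Sec E M) (z : E × E) : E :=
  baseRep c ((chart E c).symm z).proj (X ((chart E c).symm z))

/-- The local representative of a vector field on `TM`. -/
def vfRep (c : M) (ξ : VF E M) (z : E × E) : E × E :=
  tmRep c ((chart E c).symm z) (ξ ((chart E c).symm z))

lemma contMDiffAt_sec_iff_secRep {c : M} {u : TM E M} (h : u.proj ∈ (chartAt E c).source) (X : Sec E M) :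
    ContMDiffAt (modelTM E) (modelTM E) ∞ (fun u => (⟨u.proj, X u⟩ : TM E M)) u ↔
    ContDiffAt ℝ ∞ (secRep c X) (chart E c u) := by
  rw [contMDiffAt_sec_iff h, contMDiffAt_iff_contDiffAt_chart h]
  rfl

lemma contMDiffAt_vf_iff_vfRep {c : M} {u : TM E M} (h : u.proj ∈ (chartAt E c).source) (ξ : VF E M) :
    ContMDiffAt (modelTM E) (modelTM E).tangent ∞
    (fun u => (⟨u, ξ u⟩ : TangentBundle (modelTM E) (TM E M))) u ↔
    ContDiffAt ℝ ∞ (vfRep c ξ) (chart E c u) := by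
  rw [contMDiffAt_vf_iff h, contMDiffAt_iff_contDiffAt_chart h]
  rfl

lemma chart_left_inv {c : M} {u : TM E M} (h : u.proj ∈ (chartAt E c).source) :
    (chart E c).symm (chart E c u) = u :=
  (chart E c).left_inv (by rw [chart_source]; exact h)

lemma vfRep_chart {c : M} {u : TM E M} (h : u.proj ∈ (chartAt E c).source) (ξ : VF E M) :
    vfRep c ξ (chart E c u) = tmRep c u (ξ u) := by
  rw [vfRep, chart_left_inv h]

lemma secRep_chart {c : M} {u : TM E M} (h : u.proj ∈ (chartAt E c).source) (X : Sec E M) :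
    secRep c X (chart E c u) = baseRep c u.proj (X u) := by
  rw [secRep, chart_left_inv h]

lemma dTM_eq {c : M} {u : TM E M} (h : u.proj ∈ (chartAt E c).source) {f : TM E M → ℝ}
    (hf : ContMDiffAt (modelTM E) 𝓘(ℝ, ℝ) ∞ f u) (w : TangentSpace (modelTM E) u) :
    dTM f u w = fderiv ℝ (fun z => f ((chart E c).symm z)) (chart E c u) (tmRep c u w) := by
  have h1 := (contMDiffAt_iff_contDiffAt_chart h f).1 hf
  have h2 : f =ᶠ[𝓝 u] (fun z => f ((chart E c).symm z)) ∘ chart E c := by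
    filter_upwards [(isOpen_chart_source c).mem_nhds (by rw [chart_source]; exact h)] with v hv
    simp [(chart E c).left_inv hv]
  have h3 : MDifferentiableAt 𝓘(ℝ, E × E) 𝓘(ℝ, ℝ) (fun z => f ((chart E c).symm z)) (chart E c u) :=
    (h1.differentiableAt (by simp)).mdifferentiableAt
  rw [dTM, h2.mfderiv_eq, mfderiv_comp u h3 (mdifferentiableAt_chart h), mfderiv_eq_fderiv]
  rfl

end Charts

/-! ### Lie brackets and the canonical maps `i`, `j`, `δ` in charts -/

section BracketCharts
variable {E : Type*} [NormedAddCommGroup E] [NormedSpace ℝ E]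
  {M : Type*} [TopologicalSpace M] [ChartedSpace E M] [IsManifold 𝓘(ℝ, E) ∞ M]

attribute [local instance] isManifold_one

lemma inverse_mfderiv_chart_symm {c : M} {z : E × E} (hz : z ∈ (chart E c).target) :
    (mfderiv 𝓘(ℝ, E × E) (modelTM E) (chart E c).symm z).inverse = tmRep c ((chart E c).symm z) := by
  have h1 := mfderiv_extChartAt_comp_mfderivWithin_extChartAt_symm (I := modelTM E) (x := (⟨c, 0⟩ : TM E M)) hz
  have h2 := mfderivWithin_extChartAt_symm_comp_mfderiv_extChartAt (I := modelTM E) (x := (⟨c, 0⟩ : TM E M)) hz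
  have hr : range (modelTM E) = univ := ModelWithCorners.range_eq_univ _
  rw [hr, mfderivWithin_univ] at h1 h2
  exact ContinuousLinearMap.inverse_eq h2 h1

lemma vfRep_eqOn_mpullback (c : M) (ξ : VF E M) :
    EqOn (vfRep c ξ) (VectorField.mpullback 𝓘(ℝ, E × E) (modelTM E) (chart E c).symm ξ) (chart E c).target := by
  intro z hz
  rw [vfRep, VectorField.mpullback_apply, inverse_mfderiv_chart_symm hz]
  rfl

lemma chart_mem_target {c : M} {u : TM E M} (h : u.proj ∈ (chartAt E c).source) :
    chart E c u ∈ (chart E c).target := (chart E c).map_source (by rw [chart_source]; exact h)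

/-- Brackets commute with pull-back, and `vfRep c ξ` is the pull-back of `ξ` under the inverse
chart. -/
lemma tmRep_bracket {c : M} {u : TM E M} (h : u.proj ∈ (chartAt E c).source)
    [CompleteSpace E] {ξ η : VF E M} (hξ : ContDiffAt ℝ ∞ (vfRep c ξ) (chart E c u))
    (hη : ContDiffAt ℝ ∞ (vfRep c η) (chart E c u)) :
    tmRep c u (bracket ξ η u) =
      VectorField.lieBracket ℝ (vfRep c ξ) (vfRep c η) (chart E c u) := by
  have hz := chart_mem_target h
  have h1 := ((contMDiffAt_vf_iff_vfRep h ξ).2 hξ).mdifferentiableAt (by simp)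
  have h2 := ((contMDiffAt_vf_iff_vfRep h η).2 hη).mdifferentiableAt (by simp)
  rw [← chart_left_inv h] at h1 h2
  have : IsManifold (modelTM E) (minSmoothness ℝ 3) (TM E M) := by
    rw [minSmoothness_of_isRCLikeNormedField]
    exact IsManifold.of_le (n := ∞) (WithTop.coe_le_coe.2 (le_top : (3 : ℕ∞) ≤ ⊤))
  have key := VectorField.mpullback_mlieBracket (I := 𝓘(ℝ, E × E)) (I' := modelTM E) (n := ∞) h1 h2 (contMDiffAt_chart_symm hz) (by
    rw [minSmoothness_of_isRCLikeNormedField]; exact WithTop.coe_le_coe.2 (le_top : (2 : ℕ∞) ≤ ⊤))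
  rw [← vfRep_eqOn_mpullback c _ hz] at key
  have e1 : ∀ ζ : VF E M, vfRep c ζ =ᶠ[𝓝 (chart E c u)] VectorField.mpullback 𝓘(ℝ, E × E) (modelTM E) (chart E c).symm ζ := fun ζ =>
    eventuallyEq_of_mem ((isOpen_chart_target c).mem_nhds hz) (vfRep_eqOn_mpullback c ζ)
  rw [vfRep_chart h] at key
  have e2 : ∀ V W : ∀ z : E × E, TangentSpace 𝓘(ℝ, E × E) z, VectorField.mlieBracket 𝓘(ℝ, E × E) V W (chart E c u) =
      VectorField.lieBracket ℝ V W (chart E c u) := fun V W => by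
    rw [← VectorField.mlieBracketWithin_univ, VectorField.mlieBracketWithin_eq_lieBracketWithin]
    exact congrFun (VectorField.lieBracketWithin_univ (E := E × E) (V := V) (W := W)) _
  exact (key.trans (e2 _ _)).trans ((e1 ξ).symm.lieBracket_vectorField_eq (e1 η).symm)

lemma fibreIncl_chart {c : M} {p : M} (h : p ∈ (chartAt E c).source) (w : E) :
    chart E c (fibreIncl p w) = (extChartAt 𝓘(ℝ, E) c p, baseRep c p w) :=
  chart_apply (u := fibreIncl p w) h

lemma mdifferentiableAt_fibreIncl (p : M) (w : E) :
    MDifferentiableAt 𝓘(ℝ, E) (modelTM E) (fibreIncl (E := E) p) w := by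
  have : ContMDiffAt 𝓘(ℝ, E) (modelTM E) ∞ (fibreIncl (E := E) p) w := by
    rw [Bundle.contMDiffAt_totalSpace]
    refine ⟨contMDiffAt_const, ?_⟩
    have : (fun x : E => (trivializationAt E (TangentSpace 𝓘(ℝ, E)) p (fibreIncl p x)).2) = fun x => baseRep p p x := by
      funext x
      exact congrArg Prod.snd (fibreIncl_chart (mem_chart_source E p) x)
    refine ContMDiffAt.congr_of_eventuallyEq ?_ (Filter.EventuallyEq.of_eq this)
    let L : E →L[ℝ] E := baseRep p p
    exact (L.contDiff (n := ∞)).contDiffAt.contMDiffAt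
  exact this.mdifferentiableAt (by simp)

/-- In the chart the inclusion of a fibre is affine, with constant first component and linear part
`baseRep`. -/
lemma tmRep_iMap {c : M} {u : TM E M} (h : u.proj ∈ (chartAt E c).source)
    (w : TangentSpace 𝓘(ℝ, E) u.proj) : tmRep c u (iMap u w) = (0, baseRep c u.proj w) := by
  have h1 : MDifferentiableAt 𝓘(ℝ, E) (modelTM E) (fibreIncl (E := E) u.proj) (fibreVec u) :=
    mdifferentiableAt_fibreIncl _ _
  have h2 := mfderiv_comp (fibreVec u) (mdifferentiableAt_chart (u := fibreIncl u.proj (fibreVec u)) h) h1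
  have h3 : tmRep c u (iMap u w) = (mfderiv 𝓘(ℝ, E) 𝓘(ℝ, E × E) (chart E c ∘ fibreIncl u.proj) (fibreVec u)) w := by
    rw [h2]; rfl
  have h4 : chart E c ∘ fibreIncl u.proj = fun x : E => (extChartAt 𝓘(ℝ, E) c u.proj, (baseRep c u.proj : E →L[ℝ] E) x) := by
    funext x
    exact fibreIncl_chart h x
  rw [h3, h4, mfderiv_eq_fderiv]
  have h5 : HasFDerivAt (fun x : E => (extChartAt 𝓘(ℝ, E) c u.proj, (baseRep c u.proj : E →L[ℝ] E) x)) ((0 : E →L[ℝ] E).prod (baseRep c u.proj : E →L[ℝ] E)) (fibreVec u) :=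
    (hasFDerivAt_const _ _).prodMk (baseRep c u.proj : E →L[ℝ] E).hasFDerivAt
  have h6 := congrArg (fun L : E →L[ℝ] E × E => L w) h5.fderiv
  exact h6

lemma baseRep_jMap {c : M} {u : TM E M} (h : u.proj ∈ (chartAt E c).source)
    (w : TangentSpace (modelTM E) u) : baseRep c u.proj (jMap u w) = (tmRep c u w).1 := by
  have h1 : MDifferentiableAt (modelTM E) 𝓘(ℝ, E) (fun v : TM E M => v.proj) u :=
    (Bundle.contMDiffAt_proj (n := ∞) (TangentSpace 𝓘(ℝ, E) (M := M))).mdifferentiableAt (by simp)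
  have h2 := mfderiv_comp u (mdifferentiableAt_extChartAt (I := 𝓘(ℝ, E)) h) h1
  have h3 : extChartAt 𝓘(ℝ, E) c ∘ (fun v : TM E M => v.proj) =ᶠ[𝓝 u] Prod.fst ∘ chart E c := by
    filter_upwards [(isOpen_chart_source c).mem_nhds (by rw [chart_source]; exact h)] with v hv
    rw [chart_source] at hv
    simp [chart_apply (u := v) hv]
  have h4 : MDifferentiableAt 𝓘(ℝ, E × E) 𝓘(ℝ, E) (Prod.fst : E × E → E) (chart E c u) :=
    differentiableAt_fst.mdifferentiableAt
  have h5 := mfderiv_comp u h4 (mdifferentiableAt_chart h)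
  rw [h3.mfderiv_eq, h5] at h2
  have h6 := congrArg (fun L : E × E →L[ℝ] E => L (tmRep c u w)) (fderiv_fst (𝕜 := ℝ) (p := chart E c u))
  have h7 := congrArg (fun L : TangentSpace (modelTM E) u →L[ℝ] E => L w) h2
  rw [mfderiv_eq_fderiv] at h7
  exact h7.symm.trans h6

lemma baseRep_delta {c : M} {u : TM E M} (h : u.proj ∈ (chartAt E c).source) :
    baseRep c u.proj (delta u) = (chart E c u).2 := by
  rw [chart_apply h]; rfl
end BracketCharts

/-! ### Functions and vector fields on the base; complete lifts -/

section BaseFields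
variable {E : Type*} [NormedAddCommGroup E] [NormedSpace ℝ E]
  {M : Type*} [TopologicalSpace M] [ChartedSpace E M] [IsManifold 𝓘(ℝ, E) ∞ M]

attribute [local instance] isManifold_one

lemma contMDiffAt_baseVF_iff {c p : M} (h : p ∈ (chartAt E c).source) (X : ∀ p : M, TangentSpace 𝓘(ℝ, E) p) :
    ContMDiffAt 𝓘(ℝ, E) (modelTM E) ∞ (fun p => (⟨p, X p⟩ : TM E M)) p ↔
    ContMDiffAt 𝓘(ℝ, E) 𝓘(ℝ, E) ∞ (fun p => baseRep c p (X p)) p := by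
  have := (trivializationAt E (TangentSpace 𝓘(ℝ, E)) c).contMDiffAt_section_iff (IB := 𝓘(ℝ, E)) (n := ∞) (s := X) h
  refine this.trans (Filter.EventuallyEq.contMDiffAt_iff ?_)
  filter_upwards [(chartAt E c).open_source.mem_nhds h] with v hv
  exact congrArg Prod.snd (chart_apply (c := c) (u := (⟨v, X v⟩ : TM E M)) hv)

lemma contMDiffAt_iff_contDiffAt_extChartAt {c p : M} (h : p ∈ (chartAt E c).source)
    {V : Type*} [NormedAddCommGroup V] [NormedSpace ℝ V] (f : M → V) :
    ContMDiffAt 𝓘(ℝ, E) 𝓘(ℝ, V) ∞ f p ↔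
      ContDiffAt ℝ ∞ (fun x => f ((extChartAt 𝓘(ℝ, E) c).symm x)) (extChartAt 𝓘(ℝ, E) c p) := by
  rw [contMDiffAt_iff_source_of_mem_source h]
  have hr : range 𝓘(ℝ, E) = univ := ModelWithCorners.range_eq_univ _
  rw [hr, contMDiffWithinAt_univ, contMDiffAt_iff_contDiffAt]
  rfl

/-- The local representative of a vector field on the base. -/
def baseVFRep (c : M) (X : ∀ p : M, TangentSpace 𝓘(ℝ, E) p) (x : E) : E :=
  baseRep c ((extChartAt 𝓘(ℝ, E) c).symm x) (X ((extChartAt 𝓘(ℝ, E) c).symm x))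

lemma SmoothBaseVF.contDiffAt {X : ∀ p : M, TangentSpace 𝓘(ℝ, E) p} (hX : SmoothBaseVF X)
    {c p : M} (h : p ∈ (chartAt E c).source) :
    ContDiffAt ℝ ∞ (baseVFRep c X) (extChartAt 𝓘(ℝ, E) c p) :=
  (contMDiffAt_iff_contDiffAt_extChartAt h _).1 ((contMDiffAt_baseVF_iff h X).1 (hX p))

lemma extChartAt_left_inv' {c p : M} (h : p ∈ (chartAt E c).source) :
    (extChartAt 𝓘(ℝ, E) c).symm (extChartAt 𝓘(ℝ, E) c p) = p :=
  (extChartAt 𝓘(ℝ, E) c).left_inv (by rwa [extChartAt_source])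

lemma mem_chart_target_iff' {c : M} {z : E × E} : z ∈ (chart E c).target ↔ z.1 ∈ (extChartAt 𝓘(ℝ, E) c).target := by
  rw [chart_target, mem_prod]; simp

lemma chart_symm_mem {c : M} {z : E × E} (hz : z ∈ (chart E c).target) :
    ((chart E c).symm z).proj ∈ (chartAt E c).source := by
  have := (chart E c).map_target hz
  rwa [chart_source] at this

lemma chart_symm_proj {c : M} {z : E × E} (hz : z ∈ (chart E c).target) :
    ((chart E c).symm z).proj = (extChartAt 𝓘(ℝ, E) c).symm z.1 := by
  have h := chart_symm_mem hz
  have h1 := chart_apply h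
  rw [(chart E c).right_inv hz] at h1
  rw [congrArg Prod.fst h1]
  exact (extChartAt_left_inv' h).symm

lemma baseRep_chart_symm {c : M} {z : E × E} (hz : z ∈ (chart E c).target) :
    baseRep c ((chart E c).symm z).proj ((chart E c).symm z).2 = z.2 := by
  have h1 := chart_apply (chart_symm_mem hz)
  rw [(chart E c).right_inv hz] at h1
  exact (congrArg Prod.snd h1).symm

lemma secRep_basic {c : M} (X : ∀ p : M, TangentSpace 𝓘(ℝ, E) p) {z : E × E} (hz : z ∈ (chart E c).target) :
    secRep c (basic X) z = baseVFRep c X z.1 := by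
  unfold secRep baseVFRep basic
  rw [chart_symm_proj hz]

lemma mfderiv_eq_fderiv_rep {c p : M} (h : p ∈ (chartAt E c).source) {f : M → ℝ}
    (hf : ContMDiffAt 𝓘(ℝ, E) 𝓘(ℝ, ℝ) ∞ f p) (w : TangentSpace 𝓘(ℝ, E) p) :
    (mfderiv 𝓘(ℝ, E) 𝓘(ℝ, ℝ) f p w : ℝ) = fderiv ℝ (fun x => f ((extChartAt 𝓘(ℝ, E) c).symm x)) (extChartAt 𝓘(ℝ, E) c p) (baseRep c p w) := by
  have h1 := (contMDiffAt_iff_contDiffAt_extChartAt h f).1 hf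
  have h2 : f =ᶠ[𝓝 p] (fun x => f ((extChartAt 𝓘(ℝ, E) c).symm x)) ∘ extChartAt 𝓘(ℝ, E) c := by
    filter_upwards [(chartAt E c).open_source.mem_nhds h] with v hv
    simp only [Function.comp_apply, extChartAt_left_inv' hv]
  have h3 : MDifferentiableAt 𝓘(ℝ, E) 𝓘(ℝ, ℝ) (fun x => f ((extChartAt 𝓘(ℝ, E) c).symm x)) (extChartAt 𝓘(ℝ, E) c p) :=
    (h1.differentiableAt (by simp)).mdifferentiableAt
  rw [h2.mfderiv_eq, mfderiv_comp p h3 (mdifferentiableAt_extChartAt h), mfderiv_eq_fderiv]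
  rfl

lemma fderiv_fderiv_apply {V W : Type*} [NormedAddCommGroup V] [NormedSpace ℝ V] [NormedAddCommGroup W] [NormedSpace ℝ W]
    {f : V → W} {g : V → V} {x : V} (hf : ContDiffAt ℝ ∞ f x) (hg : DifferentiableAt ℝ g x) (v : V) :
    fderiv ℝ (fun x => fderiv ℝ f x (g x)) x v = fderiv ℝ (fderiv ℝ f) x v (g x) + fderiv ℝ f x (fderiv ℝ g x v) := by
  have h1 : DifferentiableAt ℝ (fderiv ℝ f) x := (hf.fderiv_right (m := ∞) (by simp)).differentiableAt (by simp)
  rw [fderiv_clm_apply h1 hg]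
  simp [add_comm]

lemma snd_symm {V W : Type*} [NormedAddCommGroup V] [NormedSpace ℝ V] [NormedAddCommGroup W] [NormedSpace ℝ W]
    {f : V → W} {x : V} (hf : ContDiffAt ℝ ∞ f x) (v w : V) :
    fderiv ℝ (fderiv ℝ f) x v w = fderiv ℝ (fderiv ℝ f) x w v :=
  (hf.isSymmSndFDerivAt (by rw [minSmoothness_of_isRCLikeNormedField]; exact WithTop.coe_le_coe.2 (le_top : (2 : ℕ∞) ≤ ⊤))) v w

/-- Complete lifts are tested on global functions only, so there must be enough of them: a linear
function in the chart, cut off by a bump function, has any given differential at `p`. -/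
lemma exists_fun_fderiv_eq [FiniteDimensional ℝ E] [T2Space M] {c p : M} (h : p ∈ (chartAt E c).source) (L : E →L[ℝ] ℝ) :
    ∃ f : M → ℝ, ContMDiff 𝓘(ℝ, E) 𝓘(ℝ, ℝ) ∞ f ∧
      fderiv ℝ (fun x => f ((extChartAt 𝓘(ℝ, E) c).symm x)) (extChartAt 𝓘(ℝ, E) c p) = L := by
  let b : SmoothBumpFunction 𝓘(ℝ, E) p := Classical.arbitrary _
  have hp := mem_chart_source E p
  -- The bump function lives in the chart centred at `p`, the differential is read in the chart at
  -- `c`; `L'` is `L` composed with the derivative of the transition map.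
  let L' : E →L[ℝ] ℝ := L.comp ((baseRep c p).comp (baseRep p p).inverse)
  have hf : ContMDiff 𝓘(ℝ, E) 𝓘(ℝ, ℝ) ∞ fun q => b q • L' (extChartAt 𝓘(ℝ, E) p q) :=
    b.contMDiff_smul (L'.contDiff.contMDiff.comp_contMDiffOn contMDiffOn_extChartAt)
  refine ⟨_, hf, ?_⟩
  ext v
  obtain ⟨w, hw⟩ : ∃ w : TangentSpace 𝓘(ℝ, E) p, baseRep c p w = v := ⟨_, (isInvertible_baseRep (E := E) h).self_apply_inverse v⟩
  rw [← hw, ← mfderiv_eq_fderiv_rep h (hf p), mfderiv_eq_fderiv_rep hp (hf p)]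
  have : (fun x => b ((extChartAt 𝓘(ℝ, E) p).symm x) • L' (extChartAt 𝓘(ℝ, E) p ((extChartAt 𝓘(ℝ, E) p).symm x)))
      =ᶠ[𝓝 (extChartAt 𝓘(ℝ, E) p p)] L' := by
    have h1 : ∀ᶠ x in 𝓝 (extChartAt 𝓘(ℝ, E) p p), b ((extChartAt 𝓘(ℝ, E) p).symm x) = 1 := by
      have hc : ContinuousAt (extChartAt 𝓘(ℝ, E) p).symm (extChartAt 𝓘(ℝ, E) p p) := continuousAt_extChartAt_symm p
      rw [ContinuousAt, extChartAt_left_inv' hp] at hc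
      exact hc b.eventuallyEq_one
    filter_upwards [h1, extChartAt_target_mem_nhds (I := 𝓘(ℝ, E)) p] with x hx hx'
    rw [hx, one_smul, (extChartAt 𝓘(ℝ, E) p).right_inv hx']
  rw [this.fderiv_eq, L'.fderiv]
  have := (isInvertible_baseRep (E := E) hp).inverse_apply_self w
  show L (baseRep c p ((baseRep p p).inverse (baseRep p p w))) = _
  rw [this]

/-- The connection is characterized on global vector fields; their values fill each tangent space
because a field that is constant in a chart can be cut off. -/
lemma exists_smoothBaseVF_eq [FiniteDimensional ℝ E] [T2Space M] (p : M) (w : TangentSpace 𝓘(ℝ, E) p) :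
    ∃ X : ∀ p : M, TangentSpace 𝓘(ℝ, E) p, SmoothBaseVF X ∧ X p = w := by
  let b : SmoothBumpFunction 𝓘(ℝ, E) p := Classical.arbitrary _
  let L : ∀ q : M, E →L[ℝ] TangentSpace 𝓘(ℝ, E) q := fun q => (baseRep p q).inverse
  refine ⟨fun q => b q • L q (baseRep p p w), fun q => ?_, ?_⟩
  · by_cases hq : q ∈ (chartAt E p).source
    · rw [contMDiffAt_baseVF_iff hq]
      have : ContMDiffAt 𝓘(ℝ, E) 𝓘(ℝ, E) ∞ (fun q => b q • (baseRep p p w : E)) q :=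
        b.contMDiff.contMDiffAt.smul contMDiffAt_const
      refine this.congr_of_eventuallyEq ?_
      filter_upwards [(chartAt E p).open_source.mem_nhds hq] with v hv
      rw [map_smul]
      congr 1
      have := isInvertible_baseRep (E := E) hv
      exact this.self_apply_inverse _
    · have h0 : ContMDiffAt 𝓘(ℝ, E) (modelTM E) ∞ (fun p => (⟨p, 0⟩ : TM E M)) q :=
        (Bundle.contMDiff_zeroSection ℝ (TangentSpace 𝓘(ℝ, E) (M := M))) q
      refine h0.congr_of_eventuallyEq ?_
      have : q ∉ tsupport b := fun h => hq (b.tsupport_subset_chartAt_source h)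
      filter_upwards [(isClosed_tsupport b).isOpen_compl.mem_nhds this] with v hv
      rw [image_eq_zero_of_notMem_tsupport hv, zero_smul]
  · have := (isInvertible_baseRep (E := E) (mem_chart_source E p)).inverse_apply_self w
    show b p • L p (baseRep p p w) = w
    rw [b.eq_one, one_smul]
    exact this

/-- Both sides of `X^c f^c = (X f)^c` consist of a Hessian term and a first-order term. Once the
base components agree, the Hessian terms are equal by symmetry, and comparing first-order terms
fixes the fibre component. The formula thus gives a solution, and every solution is of this form. -/
lemma tmRep_completeLift [FiniteDimensional ℝ E] [T2Space M] {X : ∀ p : M, TangentSpace 𝓘(ℝ, E) p} (hX : SmoothBaseVF X)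
    {c : M} {u : TM E M} (h : u.proj ∈ (chartAt E c).source) :
    tmRep c u (completeLift X u) =
      (baseVFRep c X (chart E c u).1, fderiv ℝ (baseVFRep c X) (chart E c u).1 (chart E c u).2) := by
  set z := chart E c u with hz
  have hz1 : z.1 = extChartAt 𝓘(ℝ, E) c u.proj := congrArg Prod.fst (chart_apply h)
  have hz2 : z.2 = baseRep c u.proj u.2 := congrArg Prod.snd (chart_apply h)
  have hXd := hX.contDiffAt h
  rw [← hz1] at hXd
  have hX1 : baseVFRep c X z.1 = baseRep c u.proj (X u.proj) := by
    rw [baseVFRep, hz1, extChartAt_left_inv' h]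
  have hF : ∀ f : M → ℝ, ContMDiff 𝓘(ℝ, E) 𝓘(ℝ, ℝ) ∞ f → ContDiffAt ℝ ∞ (fun x => f ((extChartAt 𝓘(ℝ, E) c).symm x)) z.1 :=
    fun f hf => hz1 ▸ (contMDiffAt_iff_contDiffAt_extChartAt h f).1 (hf u.proj)
  have key1 : ∀ ξ : TangentSpace (modelTM E) u, ∀ f : M → ℝ, ContMDiff 𝓘(ℝ, E) 𝓘(ℝ, ℝ) ∞ f →
      dTM (fun v : TM E M => (mfderiv 𝓘(ℝ, E) 𝓘(ℝ, ℝ) f v.proj v.2 : ℝ)) u ξ =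
      fderiv ℝ (fderiv ℝ (fun x => f ((extChartAt 𝓘(ℝ, E) c).symm x))) z.1 (tmRep c u ξ).1 z.2 +
      fderiv ℝ (fun x => f ((extChartAt 𝓘(ℝ, E) c).symm x)) z.1 (tmRep c u ξ).2 := by
    intro ξ f hf
    set F := fun x => f ((extChartAt 𝓘(ℝ, E) c).symm x)
    let g : TM E M → ℝ := fun v => mfderiv 𝓘(ℝ, E) 𝓘(ℝ, ℝ) f v.proj v.2
    have e : (fun y : E × E => g ((chart E c).symm y)) =ᶠ[𝓝 z]
        fun y => fderiv ℝ F y.1 y.2 := by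
      filter_upwards [(isOpen_chart_target c).mem_nhds (chart_mem_target h)] with y hy
      simp only [g]
      rw [mfderiv_eq_fderiv_rep (chart_symm_mem hy) (hf _), baseRep_chart_symm hy, chart_symm_proj hy,
        (extChartAt 𝓘(ℝ, E) c).right_inv (mem_chart_target_iff'.1 hy)]
    have hd : ContDiffAt ℝ ∞ (fderiv ℝ F) z.1 := (hF f hf).fderiv_right (m := ∞) (by simp)
    have hd2 : ContDiffAt ℝ ∞ (fun y : E × E => fderiv ℝ F y.1 y.2) z :=
      (hd.comp z contDiffAt_fst).clm_apply contDiffAt_snd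
    refine (dTM_eq (f := g) h ((contMDiffAt_iff_contDiffAt_chart h _).2 (hd2.congr_of_eventuallyEq e)) ξ).trans ?_
    rw [e.fderiv_eq]
    have h1 : HasFDerivAt (fun y : E × E => fderiv ℝ F y.1) ((fderiv ℝ (fderiv ℝ F) z.1).comp (ContinuousLinearMap.fst ℝ E E)) z :=
      (hd.differentiableAt (by simp)).hasFDerivAt.comp z hasFDerivAt_fst
    rw [(h1.clm_apply hasFDerivAt_snd).fderiv]
    simp [add_comm]
  have key2 : ∀ f : M → ℝ, ContMDiff 𝓘(ℝ, E) 𝓘(ℝ, ℝ) ∞ f →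
      (mfderiv 𝓘(ℝ, E) 𝓘(ℝ, ℝ)
          (fun p : M => (mfderiv 𝓘(ℝ, E) 𝓘(ℝ, ℝ) f p (X p) : ℝ)) u.proj u.2 : ℝ) =
      fderiv ℝ (fderiv ℝ (fun x => f ((extChartAt 𝓘(ℝ, E) c).symm x))) z.1 (baseVFRep c X z.1) z.2 +
      fderiv ℝ (fun x => f ((extChartAt 𝓘(ℝ, E) c).symm x)) z.1 (fderiv ℝ (baseVFRep c X) z.1 z.2) := by
    intro f hf
    set F := fun x => f ((extChartAt 𝓘(ℝ, E) c).symm x)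
    let g : M → ℝ := fun p => mfderiv 𝓘(ℝ, E) 𝓘(ℝ, ℝ) f p (X p)
    have e : (fun x : E => g ((extChartAt 𝓘(ℝ, E) c).symm x)) =ᶠ[𝓝 z.1]
        fun x => fderiv ℝ F x (baseVFRep c X x) := by
      have ht : z.1 ∈ (extChartAt 𝓘(ℝ, E) c).target := mem_chart_target_iff'.1 (chart_mem_target h)
      filter_upwards [(isOpen_extChartAt_target c).mem_nhds ht] with y hy
      have hs := (extChartAt 𝓘(ℝ, E) c).map_target hy
      rw [extChartAt_source] at hs
      simp only [g]
      rw [mfderiv_eq_fderiv_rep hs (hf _), (extChartAt 𝓘(ℝ, E) c).right_inv hy]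
      rfl
    have hd : ContDiffAt ℝ ∞ (fderiv ℝ F) z.1 := (hF f hf).fderiv_right (m := ∞) (by simp)
    have hd2 := (hd.clm_apply hXd).congr_of_eventuallyEq e
    refine (mfderiv_eq_fderiv_rep (f := g) h ((contMDiffAt_iff_contDiffAt_extChartAt h _).2 (hz1 ▸ hd2)) _).trans ?_
    rw [← hz1, e.fderiv_eq, ← hz2,
      fderiv_fderiv_apply (hF f hf) (hXd.differentiableAt (by simp)), snd_symm (hF f hf)]
  obtain ⟨ξ₀, hξ₀⟩ : ∃ ξ, tmRep c u ξ = (baseVFRep c X z.1, fderiv ℝ (baseVFRep c X) z.1 z.2) :=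
    ⟨_, (isInvertible_tmRep h).self_apply_inverse _⟩
  have hspec := Classical.epsilon_spec (p := fun ξ : TangentSpace (modelTM E) u =>
    jMap u ξ = X u.proj ∧
    ∀ f : M → ℝ, ContMDiff 𝓘(ℝ, E) 𝓘(ℝ, ℝ) ∞ f →
      dTM (fun v : TM E M => (mfderiv 𝓘(ℝ, E) 𝓘(ℝ, ℝ) f v.proj v.2 : ℝ)) u ξ =
        (mfderiv 𝓘(ℝ, E) 𝓘(ℝ, ℝ)
          (fun p : M => (mfderiv 𝓘(ℝ, E) 𝓘(ℝ, ℝ) f p (X p) : ℝ)) u.proj u.2 : ℝ)) ⟨ξ₀, by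
    refine ⟨?_, fun f hf => ?_⟩
    · apply (isInvertible_baseRep h).injective
      rw [baseRep_jMap h, hξ₀, hX1]
    · refine (key1 ξ₀ f hf).trans (Eq.trans ?_ (key2 f hf).symm)
      rw [hξ₀]⟩
  change (jMap u (completeLift X u) = X u.proj ∧ _) at hspec
  obtain ⟨h1, h2⟩ := hspec
  have h3 : (tmRep c u (completeLift X u)).1 = baseRep c u.proj (X u.proj) := by
    rw [← baseRep_jMap h, h1]
  refine Prod.ext (h3.trans hX1.symm) ?_
  refine (SeparatingDual.eq_iff_forall_dual_eq (R := ℝ)).2 fun L => ?_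
  obtain ⟨f, hf, hfL⟩ := exists_fun_fderiv_eq h L
  have h4 := ((key1 (completeLift X u) f hf).symm.trans (h2 f hf)).trans (key2 f hf)
  rw [h3, hX1] at h4
  rw [← hfL, ← hz1]
  exact add_left_cancel h4

end BaseFields

/-! ### Connection and curvature of a spray on a vector space -/

section FlatSpray
variable {E : Type*} [NormedAddCommGroup E] [NormedSpace ℝ E]

/-- The connection coefficients of the spray `(x, y) ↦ (y, s (x, y))` on a vector space. -/
def flatConn (s : E × E → E) (z : E × E) : E →L[ℝ] E :=
  (1 / 2 : ℝ) • (fderiv ℝ s z).comp (ContinuousLinearMap.inr ℝ E E)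

lemma flatConn_apply (s : E × E → E) (z : E × E) (a : E) :
    flatConn s z a = (1 / 2 : ℝ) • fderiv ℝ s z (0, a) := rfl

lemma contDiffAt_flatConn {s : E × E → E} {z : E × E} (hs : ContDiffAt ℝ ∞ s z) :
    ContDiffAt ℝ ∞ (flatConn s) z :=
  ((hs.fderiv_right (m := ∞) (by simp)).clm_comp contDiffAt_const).const_smul _

/-- The covector-valued derivative of the connection coefficients in horizontal directions. -/
def flatHorDeriv (s : E × E → E) (z : E × E) : E →L[ℝ] E →L[ℝ] E :=
  (fderiv ℝ (flatConn s) z).comp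
    (ContinuousLinearMap.inl ℝ E E + (ContinuousLinearMap.inr ℝ E E).comp (flatConn s z))

lemma contDiffAt_flatHorDeriv {s : E × E → E} {z : E × E} (hs : ContDiffAt ℝ ∞ s z) :
    ContDiffAt ℝ ∞ (flatHorDeriv s) z := by
  have h := contDiffAt_flatConn hs
  exact (h.fderiv_right (m := ∞) (by simp)).clm_comp
    (contDiffAt_const.add (contDiffAt_const.clm_comp h))

/-- The curvature of a spray on a vector space. -/
def flatCurv (s : E × E → E) (z : E × E) : E →L[ℝ] E →L[ℝ] E :=
  (flatHorDeriv s z).flip - flatHorDeriv s z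

lemma contDiffAt_flatCurv {s : E × E → E} {z : E × E} (hs : ContDiffAt ℝ ∞ s z) :
    ContDiffAt ℝ ∞ (flatCurv s) z := by
  have h := contDiffAt_flatHorDeriv hs
  exact ((ContinuousLinearMap.flipₗᵢ ℝ E E E).contDiff.contDiffAt.comp z h).sub h

lemma flatCurv_apply (s : E × E → E) (z : E × E) (a b : E) :
    flatCurv s z a b = fderiv ℝ (flatConn s) z (b, flatConn s z b) a -
      fderiv ℝ (flatConn s) z (a, flatConn s z a) b := by
  simp only [flatCurv, flatHorDeriv, sub_apply, ContinuousLinearMap.flip_apply,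
    ContinuousLinearMap.comp_apply, add_apply, ContinuousLinearMap.inl_apply,
    ContinuousLinearMap.inr_apply, Prod.mk_add_mk, add_zero, zero_add]

lemma flatCurv_self (s : E × E → E) (z : E × E) (a : E) : flatCurv s z a a = 0 := by
  rw [flatCurv_apply, sub_self]

lemma flatCurv_swap (s : E × E → E) (z : E × E) (a b : E) : flatCurv s z a b = -flatCurv s z b a := by
  rw [flatCurv_apply, flatCurv_apply, neg_sub]

/-- Tensoriality: the derivatives of `X` and `Y` contribute a horizontal vector, which the vertical
projection removes. Only derivatives of the connection coefficients survive. -/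
lemma vert_lieBracket_hor {s : E × E → E} {z : E × E} (hs : ContDiffAt ℝ ∞ s z) {X Y : E × E → E}
    (hX : DifferentiableAt ℝ X z) (hY : DifferentiableAt ℝ Y z) :
    (VectorField.lieBracket ℝ (fun z => (X z, flatConn s z (X z))) (fun z => (Y z, flatConn s z (Y z))) z).2 -
      flatConn s z (VectorField.lieBracket ℝ (fun z => (X z, flatConn s z (X z))) (fun z => (Y z, flatConn s z (Y z))) z).1
    = -flatCurv s z (X z) (Y z) := by
  have hN : DifferentiableAt ℝ (flatConn s) z := (contDiffAt_flatConn hs).differentiableAt (by simp)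
  have key : ∀ {X : E × E → E}, DifferentiableAt ℝ X z → ∀ v, fderiv ℝ (fun z => (X z, flatConn s z (X z))) z v =
      (fderiv ℝ X z v, fderiv ℝ (flatConn s) z v (X z) + flatConn s z (fderiv ℝ X z v)) := by
    intro X hX v
    rw [(hX.hasFDerivAt.prodMk (hN.hasFDerivAt.clm_apply hX.hasFDerivAt)).fderiv]
    simp [add_comm]
  rw [VectorField.lieBracket, key hX, key hY, flatCurv_apply]
  simp only [Prod.fst_sub, Prod.snd_sub, map_sub]
  abel
end FlatSpray

/-! ### Connection, curvature and traces of a spray on a manifold -/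

section Spray
variable {E : Type*} [NormedAddCommGroup E] [NormedSpace ℝ E]
  {M : Type*} [TopologicalSpace M] [ChartedSpace E M] [IsManifold 𝓘(ℝ, E) ∞ M]

attribute [local instance] isManifold_one

lemma mem_slit_iff {c : M} {u : TM E M} (h : u.proj ∈ (chartAt E c).source) :
    u ∈ slit E M ↔ (chart E c u).2 ≠ 0 := by
  rw [← baseRep_delta h]
  refine not_congr ⟨fun h0 => ?_, fun h0 => ?_⟩
  · rw [delta, h0, map_zero]
  · exact (isInvertible_baseRep h).injective (h0.trans (map_zero _).symm)

variable (E M) in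
lemma isOpen_slit : IsOpen (slit E M) := by
  rw [isOpen_iff_mem_nhds]
  intro u hu
  have h := mem_chart_source E u.proj
  have h1 : {z : E × E | z.2 ≠ 0} ∈ 𝓝 (chart E u.proj u) :=
    (isOpen_ne_fun continuous_snd continuous_const).mem_nhds ((mem_slit_iff h).1 hu)
  filter_upwards [(continuousAt_chart h) h1, (isOpen_chart_source u.proj).mem_nhds (by rw [chart_source]; exact h)] with v hv hv'
  rw [chart_source] at hv'
  exact (mem_slit_iff hv').2 hv

lemma eventually_chart {c : M} {u : TM E M} (h : u.proj ∈ (chartAt E c).source) {U : Set (TM E M)} (hU : U ∈ 𝓝 u) :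
    ∀ᶠ z in 𝓝 (chart E c u), z ∈ (chart E c).target ∧ (chart E c).symm z ∈ U := by
  have h1 := continuousAt_chart_symm (chart_mem_target h)
  rw [ContinuousAt, chart_left_inv h] at h1
  filter_upwards [(isOpen_chart_target c).mem_nhds (chart_mem_target h), h1 hU] with z hz hz'
  exact ⟨hz, hz'⟩

/-- The second component of the local representative of a second-order vector field. -/
def sprayCoeff (c : M) (S : VF E M) (z : E × E) : E := (vfRep c S z).2

/-- Sprays: smooth second-order vector fields on the slit tangent bundle that are homogeneous of
degree two. -/
structure IsSpray (S : VF E M) : Prop where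
  smooth : SmoothVF (slit E M) S
  secondOrder : ∀ u ∈ slit E M, jMap u (S u) = delta u
  homogeneous : ∀ u ∈ slit E M, ∀ c : M, u.proj ∈ (chartAt E c).source →
    fderiv ℝ (sprayCoeff c S) (chart E c u) (0, (chart E c u).2) =
      (2 : ℝ) • sprayCoeff c S (chart E c u)

variable {S : VF E M} {c : M} {u : TM E M}

lemma SmoothVF.contDiffAt {U : Set (TM E M)} {ξ : VF E M} (hξ : SmoothVF U ξ) (hU : U ∈ 𝓝 u)
    (h : u.proj ∈ (chartAt E c).source) : ContDiffAt ℝ ∞ (vfRep c ξ) (chart E c u) :=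
  (contMDiffAt_vf_iff_vfRep h ξ).1 (ContMDiffOn.contMDiffAt hξ hU)

lemma SmoothSec.contDiffAt {U : Set (TM E M)} {X : Sec E M} (hX : SmoothSec U X) (hU : U ∈ 𝓝 u)
    (h : u.proj ∈ (chartAt E c).source) : ContDiffAt ℝ ∞ (secRep c X) (chart E c u) :=
  (contMDiffAt_sec_iff_secRep h X).1 (ContMDiffOn.contMDiffAt hX hU)

lemma slit_mem_nhds (hu : u ∈ slit E M) : slit E M ∈ 𝓝 u := (isOpen_slit E M).mem_nhds hu

namespace IsSpray

lemma contDiffAt (hS : IsSpray S) (hu : u ∈ slit E M) (h : u.proj ∈ (chartAt E c).source) :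
    ContDiffAt ℝ ∞ (sprayCoeff c S) (chart E c u) :=
  contDiffAt_snd.comp _ (SmoothVF.contDiffAt hS.smooth (slit_mem_nhds hu) h)

lemma tmRep_eq (hS : IsSpray S) (hu : u ∈ slit E M) (h : u.proj ∈ (chartAt E c).source) :
    tmRep c u (S u) = ((chart E c u).2, sprayCoeff c S (chart E c u)) := by
  refine Prod.ext ?_ ?_
  · rw [← baseRep_jMap h, hS.secondOrder u hu, baseRep_delta h]
  · rw [sprayCoeff, vfRep_chart h]

lemma vfRep_eventuallyEq (hS : IsSpray S) (hu : u ∈ slit E M) (h : u.proj ∈ (chartAt E c).source) :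
    vfRep c S =ᶠ[𝓝 (chart E c u)] fun z => (z.2, sprayCoeff c S z) := by
  filter_upwards [eventually_chart h (slit_mem_nhds hu)] with z hz
  have := hS.tmRep_eq hz.2 (chart_symm_mem hz.1)
  rwa [(chart E c).right_inv hz.1] at this

/-- Euler's relation in degree two; it means `S = H δ`. -/
lemma flatConn_apply_self (hS : IsSpray S) (hu : u ∈ slit E M) (h : u.proj ∈ (chartAt E c).source) :
    flatConn (sprayCoeff c S) (chart E c u) (chart E c u).2 = sprayCoeff c S (chart E c u) := by
  rw [flatConn_apply, hS.homogeneous u hu c h, smul_smul]; norm_num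

/-- In coordinates `X^c = (X, DX y)` and `[X^v, S] = (X, ∂_y s X - DX y)`. The derivative of `X`
cancels in the sum, so the result depends linearly on the value of `X` alone and the defining
condition of `connection` can be met. -/
lemma tmRep_connection [FiniteDimensional ℝ E] [T2Space M] (hS : IsSpray S) (hu : u ∈ slit E M)
    (h : u.proj ∈ (chartAt E c).source) (a : TangentSpace 𝓘(ℝ, E) u.proj) :
    tmRep c u (connection S u a) =
      (baseRep c u.proj a, flatConn (sprayCoeff c S) (chart E c u) (baseRep c u.proj a)) := by
  set z := chart E c u with hz
  have hz1 : z.1 = extChartAt 𝓘(ℝ, E) c u.proj := congrArg Prod.fst (chart_apply h)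
  have key : ∀ X : (∀ p : M, TangentSpace 𝓘(ℝ, E) p), SmoothBaseVF X →
      tmRep c u ((1 / 2 : ℝ) • (completeLift X u + bracket (iSec (basic X)) S u)) =
        (baseRep c u.proj (X u.proj), flatConn (sprayCoeff c S) z (baseRep c u.proj (X u.proj))) := by
    intro X hX
    have hXd := hX.contDiffAt h
    rw [← hz1] at hXd
    have hX1 : baseVFRep c X z.1 = baseRep c u.proj (X u.proj) := by
      rw [baseVFRep, hz1, extChartAt_left_inv' h]
    have e1 : vfRep c (iSec (basic X)) =ᶠ[𝓝 z] fun y => (0, baseVFRep c X y.1) := by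
      filter_upwards [(isOpen_chart_target c).mem_nhds (chart_mem_target h)] with y hy
      rw [vfRep, iSec, tmRep_iMap (chart_symm_mem hy)]
      exact congrArg _ (secRep_basic X hy)
    have e2 := hS.vfRep_eventuallyEq hu h
    have hd : DifferentiableAt ℝ (fun y : E × E => baseVFRep c X y.1) z :=
      (hXd.differentiableAt (by simp)).comp z differentiableAt_fst
    have hd1 : ContDiffAt ℝ ∞ (fun y : E × E => ((0 : E), baseVFRep c X y.1)) z :=
      contDiffAt_const.prodMk (hXd.comp z contDiffAt_fst)
    have hs := hS.contDiffAt hu h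
    rw [map_smul, map_add, tmRep_completeLift hX h,
      tmRep_bracket h (hd1.congr_of_eventuallyEq e1) (SmoothVF.contDiffAt hS.smooth (slit_mem_nhds hu) h),
      e1.lieBracket_vectorField_eq e2, VectorField.lieBracket,
      (hasFDerivAt_snd.prodMk (hs.differentiableAt (by simp)).hasFDerivAt).fderiv,
      ((hasFDerivAt_const (0 : E) z).prodMk hd.hasFDerivAt).fderiv, ← hX1]
    have hd' : fderiv ℝ (fun y : E × E => baseVFRep c X y.1) z = (fderiv ℝ (baseVFRep c X) z.1).comp (ContinuousLinearMap.fst ℝ E E) :=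
      (((hXd.differentiableAt (by simp)).hasFDerivAt).comp z hasFDerivAt_fst).fderiv
    rw [hd', flatConn_apply]
    refine Prod.ext ?_ ?_
    · simp [← hz, ← two_smul ℝ, smul_smul]
    · simp [← hz]
  let A : E × E →L[ℝ] TangentSpace (modelTM E) u := (tmRep c u).inverse
  let B : E →L[ℝ] E × E := (ContinuousLinearMap.id ℝ E).prod (flatConn (sprayCoeff c S) z)
  let L : TangentSpace 𝓘(ℝ, E) u.proj →L[ℝ] TangentSpace (modelTM E) u := A.comp (B.comp (baseRep c u.proj))
  have hL : ∀ w, tmRep c u (L w) = (baseRep c u.proj w, flatConn (sprayCoeff c S) z (baseRep c u.proj w)) :=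
    fun w => (isInvertible_tmRep h).self_apply_inverse _
  have hspec := Classical.epsilon_spec (p := fun h : TangentSpace 𝓘(ℝ, E) u.proj →ₗ[ℝ] TangentSpace (modelTM E) u =>
    ∀ X : (∀ p : M, TangentSpace 𝓘(ℝ, E) p), SmoothBaseVF X →
    h (basic X u) = (1 / 2 : ℝ) • (completeLift X u + bracket (iSec (basic X)) S u)) ⟨(L : TangentSpace 𝓘(ℝ, E) u.proj →ₗ[ℝ] TangentSpace (modelTM E) u), fun X hX =>
      (isInvertible_tmRep h).injective ((hL _).trans (key X hX).symm)⟩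
  obtain ⟨X, hX, hXa⟩ := exists_smoothBaseVF_eq u.proj a
  have h2 := congrArg (tmRep c u) (hspec X hX)
  rw [key X hX, hXa] at h2
  rw [← h2, ← hXa]
  rfl

variable [FiniteDimensional ℝ E] [T2Space M]

/-- The difference `ξ - H (j ξ)` has zero base component, so it lies in the image of `i`, and the
choice in `vertSec` is a genuine preimage. -/
lemma baseRep_vertSec (hS : IsSpray S) (hu : u ∈ slit E M)
    (h : u.proj ∈ (chartAt E c).source) (ξ : VF E M) :
    baseRep c u.proj (vertSec S ξ u) =
      (tmRep c u (ξ u)).2 - flatConn (sprayCoeff c S) (chart E c u) (tmRep c u (ξ u)).1 := by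
  have key : tmRep c u (ξ u - connection S u (jMap u (ξ u))) =
      (0, (tmRep c u (ξ u)).2 - flatConn (sprayCoeff c S) (chart E c u) (tmRep c u (ξ u)).1) := by
    rw [map_sub, hS.tmRep_connection hu h, baseRep_jMap h]
    refine Prod.ext ?_ ?_ <;> simp
  obtain ⟨w, hw⟩ : ∃ w : TangentSpace 𝓘(ℝ, E) u.proj, baseRep c u.proj w =
      (tmRep c u (ξ u)).2 - flatConn (sprayCoeff c S) (chart E c u) (tmRep c u (ξ u)).1 :=
    ⟨_, (isInvertible_baseRep h).self_apply_inverse _⟩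
  have hspec : iMap u (vertSec S ξ u) = ξ u - connection S u (jMap u (ξ u)) :=
    Classical.epsilon_spec (p := fun w : TangentSpace 𝓘(ℝ, E) u.proj =>
      iMap u w = ξ u - connection S u (jMap u (ξ u))) ⟨w, (isInvertible_tmRep h).injective (by
        rw [tmRep_iMap h, key, hw])⟩
  exact congrArg Prod.snd (((tmRep_iMap h _).symm.trans (congrArg (tmRep c u) hspec)).trans key)

lemma vfRep_horSec (hS : IsSpray S) (hu : u ∈ slit E M)
    (h : u.proj ∈ (chartAt E c).source) (X : Sec E M) :
    vfRep c (horSec S X) =ᶠ[𝓝 (chart E c u)]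
      fun z => (secRep c X z, flatConn (sprayCoeff c S) z (secRep c X z)) := by
  filter_upwards [eventually_chart h (slit_mem_nhds hu)] with z hz
  have := hS.tmRep_connection hz.2 (chart_symm_mem hz.1) (X ((chart E c).symm z))
  rwa [(chart E c).right_inv hz.1] at this

lemma contDiffAt_horSec (hS : IsSpray S) (hu : u ∈ slit E M)
    (h : u.proj ∈ (chartAt E c).source) {X : Sec E M} (hX : ContDiffAt ℝ ∞ (secRep c X) (chart E c u)) :
    ContDiffAt ℝ ∞ (vfRep c (horSec S X)) (chart E c u) :=
  (hX.prodMk ((contDiffAt_flatConn (hS.contDiffAt hu h)).clm_apply hX)).congr_of_eventuallyEq (hS.vfRep_horSec hu h X)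

lemma baseRep_curvature (hS : IsSpray S) (hu : u ∈ slit E M)
    (h : u.proj ∈ (chartAt E c).source) {X Y : Sec E M} (hX : ContDiffAt ℝ ∞ (secRep c X) (chart E c u))
    (hY : ContDiffAt ℝ ∞ (secRep c Y) (chart E c u)) :
    baseRep c u.proj (curvature S X Y u) = flatCurv (sprayCoeff c S) (chart E c u)
      (baseRep c u.proj (X u)) (baseRep c u.proj (Y u)) := by
  rw [curvature, Pi.neg_apply, map_neg, hS.baseRep_vertSec hu h,
    tmRep_bracket h (hS.contDiffAt_horSec hu h hX) (hS.contDiffAt_horSec hu h hY),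
    (hS.vfRep_horSec hu h X).lieBracket_vectorField_eq (hS.vfRep_horSec hu h Y),
    vert_lieBracket_hor (hS.contDiffAt hu h) (hX.differentiableAt (by simp)) (hY.differentiableAt (by simp)), neg_neg,
    secRep_chart h, secRep_chart h]

/-- Since `S = H δ`, the bracket `[S, H X]` is one of horizontal fields, whence `K(X) = -R(δ, X) =
R(X, δ)`. -/
lemma baseRep_jacobi (hS : IsSpray S) (hu : u ∈ slit E M)
    (h : u.proj ∈ (chartAt E c).source) {X : Sec E M} (hX : ContDiffAt ℝ ∞ (secRep c X) (chart E c u)) :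
    baseRep c u.proj (jacobi S X u) = flatCurv (sprayCoeff c S) (chart E c u)
      (baseRep c u.proj (X u)) (chart E c u).2 := by
  have e : vfRep c S =ᶠ[𝓝 (chart E c u)] fun z => (z.2, flatConn (sprayCoeff c S) z z.2) := by
    filter_upwards [eventually_chart h (slit_mem_nhds hu)] with z hz
    have h1 := hS.tmRep_eq hz.2 (chart_symm_mem hz.1)
    have h2 := hS.flatConn_apply_self hz.2 (chart_symm_mem hz.1)
    rw [(chart E c).right_inv hz.1] at h1 h2
    rw [h2]
    exact h1
  rw [jacobi, hS.baseRep_vertSec hu h,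
    tmRep_bracket h (SmoothVF.contDiffAt hS.smooth (slit_mem_nhds hu) h) (hS.contDiffAt_horSec hu h hX),
    e.lieBracket_vectorField_eq (hS.vfRep_horSec hu h X),
    vert_lieBracket_hor (hS.contDiffAt hu h) differentiableAt_snd (hX.differentiableAt (by simp)),
    secRep_chart h, flatCurv_swap, neg_neg]

lemma _root_.Finsler.smoothSec_basic {X : ∀ p : M, TangentSpace 𝓘(ℝ, E) p}
    (hX : SmoothBaseVF X) (U : Set (TM E M)) : SmoothSec U (basic X) :=
  (ContMDiff.comp hX (Bundle.contMDiff_proj _)).contMDiffOn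

/-- Basic sections take every value over `u`, so at most one endomorphism can represent `A` there.
-/
lemma _root_.Finsler.valueAt_eq {A : Sec E M → Sec E M} {u : TM E M}
    {a : TangentSpace 𝓘(ℝ, E) u.proj →ₗ[ℝ] TangentSpace 𝓘(ℝ, E) u.proj}
    (ha : ∀ X : Sec E M, SmoothSec (slit E M) X → A X u = a (X u)) : valueAt A u = a := by
  have hspec : ∀ X : Sec E M, SmoothSec (slit E M) X → A X u = valueAt A u (X u) :=
    Classical.epsilon_spec (p := fun a : TangentSpace 𝓘(ℝ, E) u.proj →ₗ[ℝ] TangentSpace 𝓘(ℝ, E) u.proj =>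
      ∀ X : Sec E M, SmoothSec (slit E M) X → A X u = a (X u)) ⟨a, ha⟩
  ext w
  obtain ⟨X, hX, rfl⟩ := exists_smoothBaseVF_eq u.proj w
  exact (hspec _ (smoothSec_basic hX _)).symm.trans (ha _ (smoothSec_basic hX _))

lemma _root_.Finsler.tr_eq {A : Sec E M → Sec E M} {u : TM E M} (h : u.proj ∈ (chartAt E c).source) {L : E →ₗ[ℝ] E}
    (hL : ∀ X : Sec E M, SmoothSec (slit E M) X → baseRep c u.proj (A X u) = L (baseRep c u.proj (X u))) :
    tr A u = LinearMap.trace ℝ E L := by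
  obtain ⟨e, he⟩ := isInvertible_baseRep (E := E) h
  rw [← he] at hL
  have : valueAt A u = e.toLinearEquiv.symm.conj L :=
    valueAt_eq fun X hX => e.injective ((hL X hX).trans (e.apply_symm_apply _).symm)
  rw [tr, this, LinearMap.trace_conj']

lemma tr_curvature (hS : IsSpray S) (hu : u ∈ slit E M)
    (h : u.proj ∈ (chartAt E c).source) {X : Sec E M} (hX : ContDiffAt ℝ ∞ (secRep c X) (chart E c u)) :
    tr (fun Z => curvature S Z X) u = LinearMap.trace ℝ E
      ((flatCurv (sprayCoeff c S) (chart E c u)).flip (baseRep c u.proj (X u)) : E →ₗ[ℝ] E) :=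
  tr_eq h fun _ hZ => hS.baseRep_curvature hu h (SmoothSec.contDiffAt hZ (slit_mem_nhds hu) h) hX

lemma tr_jacobi (hS : IsSpray S) (hu : u ∈ slit E M)
    (h : u.proj ∈ (chartAt E c).source) :
    tr (jacobi S) u = LinearMap.trace ℝ E
      ((flatCurv (sprayCoeff c S) (chart E c u)).flip (chart E c u).2 : E →ₗ[ℝ] E) :=
  tr_eq h fun _ hZ => hS.baseRep_jacobi hu h (SmoothSec.contDiffAt hZ (slit_mem_nhds hu) h)

lemma contDiffAt_trace_flatCurv {s : E × E → E} {z : E × E} (hs : ContDiffAt ℝ ∞ s z) {X : E × E → E}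
    (hX : ContDiffAt ℝ ∞ X z) :
    ContDiffAt ℝ ∞ (fun z => LinearMap.trace ℝ E ((flatCurv s z).flip (X z) : E →ₗ[ℝ] E)) z := by
  let T : (E →L[ℝ] E) →L[ℝ] ℝ := LinearMap.toContinuousLinearMap
    ((LinearMap.trace ℝ E).comp (ContinuousLinearMap.coeLM ℝ))
  have h1 : ContDiffAt ℝ ∞ (fun z => (flatCurv s z).flip) z :=
    (ContinuousLinearMap.flipₗᵢ ℝ E E E).contDiff.contDiffAt.comp z (contDiffAt_flatCurv hs)
  exact T.contDiff.contDiffAt.comp z (h1.clm_apply hX)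

lemma smoothFun_tr_jacobi (hS : IsSpray S) : SmoothFun (slit E M) (tr (jacobi S)) := by
  intro u hu
  have h := mem_chart_source E u.proj
  refine ContMDiffAt.contMDiffWithinAt ((contMDiffAt_iff_contDiffAt_chart h _).2 ?_)
  refine (contDiffAt_trace_flatCurv (hS.contDiffAt hu h) contDiffAt_snd).congr_of_eventuallyEq ?_
  filter_upwards [eventually_chart h (slit_mem_nhds hu)] with z hz
  have := hS.tr_jacobi hz.2 (chart_symm_mem hz.1)
  rwa [(chart E u.proj).right_inv hz.1] at this

lemma smoothFun_tr_curvature (hS : IsSpray S) {X : Sec E M} (hX : SmoothSec (slit E M) X) :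
    SmoothFun (slit E M) (tr (fun Z => curvature S Z X)) := by
  intro u hu
  have h := mem_chart_source E u.proj
  refine ContMDiffAt.contMDiffWithinAt ((contMDiffAt_iff_contDiffAt_chart h _).2 ?_)
  refine (contDiffAt_trace_flatCurv (hS.contDiffAt hu h) (SmoothSec.contDiffAt hX (slit_mem_nhds hu) h)).congr_of_eventuallyEq ?_
  filter_upwards [eventually_chart h (slit_mem_nhds hu)] with z hz
  have h1 := SmoothSec.contDiffAt hX (slit_mem_nhds hz.2) (chart_symm_mem hz.1)
  have := hS.tr_curvature hz.2 (chart_symm_mem hz.1) h1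
  rwa [(chart E u.proj).right_inv hz.1] at this

end IsSpray

/-- With `v = R (e 0) (e 1)` and `ω` the area form of the basis, `R = ω ⊗ v` and `tr R(·, b) = ω(v,
b)`. The claim becomes `ω(a, b) v + ω(b, v) a + ω(v, a) b = 0`, whose left-hand side is alternating
in three vectors of a plane. -/
lemma two_dim_identity {V : Type*} [AddCommGroup V] [Module ℝ V] (hdim : finrank ℝ V = 2) (R : V →ₗ[ℝ] V →ₗ[ℝ] V)
    (hR : ∀ a, R a a = 0) (a b : V) :
    R a b - LinearMap.trace ℝ V (R.flip b) • a + LinearMap.trace ℝ V (R.flip a) • b = 0 := by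
  have : Module.Finite ℝ V := Module.finite_of_finrank_pos (by omega)
  let e := Module.finBasisOfFinrankEq ℝ V hdim
  have h10 : R (e 1) (e 0) = - R (e 0) (e 1) := by
    have := hR (e 0 + e 1)
    simp only [map_add, LinearMap.add_apply, hR, zero_add, add_zero] at this
    exact eq_neg_of_add_eq_zero_left this
  have hT : ∀ b, LinearMap.trace ℝ V (R.flip b) = e.repr b 1 * e.repr (R (e 0) (e 1)) 0 - e.repr b 0 * e.repr (R (e 0) (e 1)) 1 := by
    intro b
    rw [LinearMap.trace_eq_matrix_trace ℝ e, Matrix.trace, Fin.sum_univ_two]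
    simp only [Matrix.diag_apply, LinearMap.toMatrix_apply, LinearMap.flip_apply]
    nth_rewrite 1 2 [← e.sum_repr b]
    simp only [Fin.sum_univ_two, map_add, map_smul, hR, h10]
    simp
    ring
  rw [hT, hT]
  have hab : R a b = (e.repr a 0 * e.repr b 1 - e.repr a 1 * e.repr b 0) • R (e 0) (e 1) := by
    nth_rewrite 1 [← e.sum_repr a, ← e.sum_repr b]
    simp only [Fin.sum_univ_two, map_add, map_smul, hR, h10, LinearMap.add_apply, LinearMap.smul_apply]
    module
  rw [hab]
  apply e.repr.injective
  ext i
  simp only [map_add, map_sub, map_smul, map_zero, Finsupp.add_apply, Finsupp.sub_apply, Finsupp.smul_apply, Finsupp.zero_apply, smul_eq_mul]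
  fin_cases i
  · show _ * e.repr _ 0 - _ * e.repr a 0 + _ * e.repr b 0 = 0
    ring
  · show _ * e.repr _ 1 - _ * e.repr a 1 + _ * e.repr b 1 = 0
    ring

end Spray

/-! ### Isotropy and vanishing Weyl endomorphism of sprays on surfaces -/

section Surfaces
variable {E : Type*} [NormedAddCommGroup E] [NormedSpace ℝ E] [FiniteDimensional ℝ E]
  {M : Type*} [TopologicalSpace M] [T2Space M] [ChartedSpace E M] [IsManifold 𝓘(ℝ, E) ∞ M]

attribute [local instance] isManifold_one

variable {S : VF E M} {c : M} {u : TM E M}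

/-- The curvature of a spray at a point, in the preferred chart at `c`. -/
def curvRep (c : M) (S : VF E M) (u : TM E M) : E →ₗ[ℝ] E →ₗ[ℝ] E :=
  (ContinuousLinearMap.coeLM ℝ).comp
    (flatCurv (sprayCoeff c S) (chart E c u) : E →ₗ[ℝ] E →L[ℝ] E)

lemma curvRep_apply (c : M) (S : VF E M) (u : TM E M) (a b : E) :
    curvRep c S u a b = flatCurv (sprayCoeff c S) (chart E c u) a b := rfl

lemma curvRep_flip (c : M) (S : VF E M) (u : TM E M) (b : E) :
    (curvRep c S u).flip b = ((flatCurv (sprayCoeff c S) (chart E c u)).flip b : E →ₗ[ℝ] E) := rfl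

/-- This is the plane identity for `R(X, δ) = K(X)`; the trace of `R(·, δ)` is `tr K`. Isotropy and
the vanishing of `W` are both read off from it. -/
lemma IsSpray.jacobi_eq (hdim : finrank ℝ E = 2) (hS : IsSpray S) (hu : u ∈ slit E M) {X : Sec E M}
    (hX : SmoothSec (slit E M) X) :
    jacobi S X u = tr (jacobi S) u • X u - tr (fun Z => curvature S Z X) u • delta u := by
  have h := mem_chart_source E u.proj
  have hX' := SmoothSec.contDiffAt hX (slit_mem_nhds hu) h
  apply (isInvertible_baseRep h).injective
  rw [map_sub, map_smul, map_smul, hS.baseRep_jacobi hu h hX', hS.tr_jacobi hu h, hS.tr_curvature hu h hX', baseRep_delta h]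
  have := two_dim_identity hdim (curvRep u.proj S u) (fun a => flatCurv_self _ _ a) (baseRep u.proj u.proj (X u)) (chart E u.proj u).2
  rw [curvRep_apply, curvRep_flip, curvRep_flip] at this
  rw [sub_add, sub_eq_zero] at this
  exact this

/-- Every spray on a surface is isotropic. -/
theorem IsSpray.isIsotropic (hdim : finrank ℝ E = 2) (hS : IsSpray S) : IsIsotropic S := by
  -- The form is `-tr R`. As `tr R` takes sections as arguments, its pointwise version is written in
  -- the preferred chart at each base point; smoothness then comes from the chart-free expression in
  -- `hα`.
  let α : ∀ u : TM E M, TangentSpace 𝓘(ℝ, E) u.proj →ₗ[ℝ] ℝ := fun u =>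
    -(LinearMap.trace ℝ E).comp ((curvRep u.proj S u).flip.comp (baseRep (E := E) u.proj u.proj).toLinearMap)
  have hα : ∀ X : Sec E M, SmoothSec (slit E M) X → ∀ u ∈ slit E M, α u (X u) = -tr (fun Z => curvature S Z X) u := by
    intro X hX u hu
    have h := mem_chart_source E u.proj
    rw [hS.tr_curvature hu h (SmoothSec.contDiffAt hX (slit_mem_nhds hu) h)]
    rfl
  refine ⟨tr (jacobi S), α, hS.smoothFun_tr_jacobi, fun X hX => ?_, fun X hX u hu => ?_⟩
  · exact (hS.smoothFun_tr_curvature hX).neg.congr (hα X hX)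
  · rw [hα X hX u hu, hS.jacobi_eq hdim hu hX, neg_smul, sub_eq_add_neg]

/-- The Weyl endomorphism of a spray on a surface vanishes. -/
theorem IsSpray.weyl_eq_zero (hdim : finrank ℝ E = 2) (hS : IsSpray S) {X : Sec E M}
    (hX : SmoothSec (slit E M) X) (hu : u ∈ slit E M) : weyl S X u = 0 := by
  rw [weyl, hdim, hS.jacobi_eq hdim hu hX]
  -- For `n = 2` the coefficients are 1, 1 and 0, so the term with `∇^v tr K` drops out and the
  -- others cancel.
  norm_num

end Surfaces

/-! ### Energies on a vector space: Euler relations, Euler–Lagrange equations, conservation of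
energy -/

section FlatEnergy
variable {E : Type*} [NormedAddCommGroup E] [NormedSpace ℝ E]

/-- The local representatives of energy functions of Finsler functions. -/
structure IsFlatEnergy (T : Set E) (f : E × E → ℝ) : Prop where
  isOpen : IsOpen T
  contDiffAt : ∀ z : E × E, z.1 ∈ T → z.2 ≠ 0 → ContDiffAt ℝ ∞ f z
  homogeneous : ∀ z : E × E, z.1 ∈ T → ∀ t : ℝ, 0 < t → f (z.1, t • z.2) = t ^ 2 * f z
  nondegenerate : ∀ z : E × E, z.1 ∈ T → z.2 ≠ 0 → ∀ w : E,
    (∀ v, fderiv ℝ (fderiv ℝ f) z (0, w) (0, v) = 0) → w = 0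

lemma contDiffAt_flip {U V W G : Type*} [NormedAddCommGroup U] [NormedSpace ℝ U]
    [NormedAddCommGroup V] [NormedSpace ℝ V] [NormedAddCommGroup W] [NormedSpace ℝ W]
    [NormedAddCommGroup G] [NormedSpace ℝ G] {g : U → V →L[ℝ] W →L[ℝ] G} {x : U}
    (hg : ContDiffAt ℝ ∞ g x) : ContDiffAt ℝ ∞ (fun x => (g x).flip) x := by
  have h := LinearIsometryEquiv.contDiff (𝕜 := ℝ) (n := ∞) (E := V →L[ℝ] W →L[ℝ] G)
    (F := W →L[ℝ] V →L[ℝ] G) (ContinuousLinearMap.flipₗᵢ ℝ V W G)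
  exact h.contDiffAt.comp x hg

/-- The fibrewise Hessian. -/
def flatMetric (f : E × E → ℝ) (z : E × E) : E →L[ℝ] E →L[ℝ] ℝ :=
  ((fderiv ℝ (fderiv ℝ f) z).bilinearComp (ContinuousLinearMap.inr ℝ E E)) (ContinuousLinearMap.inr ℝ E E)

lemma flatMetric_apply (f : E × E → ℝ) (z : E × E) (v w : E) :
    flatMetric f z v w = fderiv ℝ (fderiv ℝ f) z (0, v) (0, w) := rfl

/-- The right-hand side of the Euler-Lagrange equations. -/
def flatForce (f : E × E → ℝ) (z : E × E) : E →L[ℝ] ℝ :=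
  (fderiv ℝ f z).comp (ContinuousLinearMap.inl ℝ E E) -
    (fderiv ℝ (fderiv ℝ f) z (z.2, 0)).comp (ContinuousLinearMap.inr ℝ E E)

/-- The coefficients of the canonical spray of a flat energy. -/
def flatSpray (f : E × E → ℝ) (z : E × E) : E := (flatMetric f z).inverse (flatForce f z)

namespace IsFlatEnergy
variable {T : Set E} {f : E × E → ℝ} {z : E × E}

lemma eventually (hf : IsFlatEnergy T f) (hz : z.1 ∈ T) (hz' : z.2 ≠ 0) :
    ∀ᶠ y in 𝓝 z, y.1 ∈ T ∧ y.2 ≠ 0 := by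
  filter_upwards [(hf.isOpen.preimage continuous_fst).mem_nhds hz,
    (isOpen_ne_fun continuous_snd continuous_const).mem_nhds hz'] with y h1 h2
  exact ⟨h1, h2⟩

lemma contDiffAt_fderiv (hf : IsFlatEnergy T f) (hz : z.1 ∈ T) (hz' : z.2 ≠ 0) :
    ContDiffAt ℝ ∞ (fderiv ℝ f) z := (hf.contDiffAt z hz hz').fderiv_right (m := ∞) (by simp)

lemma contDiffAt_fderiv_fderiv (hf : IsFlatEnergy T f) (hz : z.1 ∈ T) (hz' : z.2 ≠ 0) :
    ContDiffAt ℝ ∞ (fderiv ℝ (fderiv ℝ f)) z := (hf.contDiffAt_fderiv hz hz').fderiv_right (m := ∞) (by simp)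

/-- Differentiate `f(x, t y) = t² f(x, y)` at `t = 1`. -/
lemma fderiv_self (hf : IsFlatEnergy T f) (hz : z.1 ∈ T) (hz' : z.2 ≠ 0) :
    fderiv ℝ f z (0, z.2) = 2 * f z := by
  have h1 : HasDerivAt (fun t : ℝ => (z.1, t • z.2)) ((0 : E), (1 : ℝ) • z.2) 1 :=
    (hasDerivAt_const (1 : ℝ) z.1).prodMk ((hasDerivAt_id (1 : ℝ)).smul_const z.2)
  have h0 : (fun t : ℝ => (z.1, t • z.2)) 1 = z := by simp
  have hd := ((hf.contDiffAt z hz hz').differentiableAt (by simp)).hasFDerivAt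
  rw [← h0] at hd
  have h2 := hd.comp_hasDerivAt (1 : ℝ) h1
  have h3 : HasDerivAt (fun t : ℝ => t ^ 2 * f z) (2 * f z) 1 := by
    simpa using (hasDerivAt_pow 2 (1 : ℝ)).mul_const (f z)
  have h4 : (f ∘ fun t : ℝ => (z.1, t • z.2)) =ᶠ[𝓝 1] fun t : ℝ => t ^ 2 * f z := by
    filter_upwards [lt_mem_nhds (zero_lt_one : (0 : ℝ) < 1)] with t ht
    exact hf.homogeneous z hz t ht
  have h5 := h2.unique (h3.congr_of_eventuallyEq h4)
  simpa using h5

lemma fderiv_fderiv_self (hf : IsFlatEnergy T f) (hz : z.1 ∈ T) (hz' : z.2 ≠ 0) (v : E × E) :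
    fderiv ℝ (fderiv ℝ f) z v (0, z.2) = 2 * fderiv ℝ f z v - fderiv ℝ f z (0, v.2) := by
  have h1 : HasFDerivAt (fun y : E × E => ((0 : E), y.2)) ((ContinuousLinearMap.inr ℝ E E).comp (ContinuousLinearMap.snd ℝ E E)) z :=
    ((ContinuousLinearMap.inr ℝ E E).comp (ContinuousLinearMap.snd ℝ E E)).hasFDerivAt
  have h2 := ((hf.contDiffAt_fderiv hz hz').differentiableAt (by simp)).hasFDerivAt.clm_apply h1
  have h3 := (((hf.contDiffAt z hz hz').differentiableAt (by simp)).hasFDerivAt).const_mul 2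
  have h4 : (fun y : E × E => fderiv ℝ f y (0, y.2)) =ᶠ[𝓝 z] fun y => 2 * f y := by
    filter_upwards [hf.eventually hz hz'] with y hy
    exact hf.fderiv_self hy.1 hy.2
  have h5 := congrArg (fun L : E × E →L[ℝ] ℝ => L v) (h2.unique (h3.congr_of_eventuallyEq h4))
  simp at h5
  linarith

lemma flatMetric_self (hf : IsFlatEnergy T f) (hz : z.1 ∈ T) (hz' : z.2 ≠ 0) (v : E) :
    flatMetric f z v z.2 = fderiv ℝ f z (0, v) := by
  rw [flatMetric_apply, hf.fderiv_fderiv_self hz hz']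
  ring

lemma flatMetric_symm (hf : IsFlatEnergy T f) (hz : z.1 ∈ T) (hz' : z.2 ≠ 0) (v w : E) :
    flatMetric f z v w = flatMetric f z w v := snd_symm (hf.contDiffAt z hz hz') _ _

lemma contDiffAt_flatMetric (hf : IsFlatEnergy T f) (hz : z.1 ∈ T) (hz' : z.2 ≠ 0) :
    ContDiffAt ℝ ∞ (flatMetric f) z := by
  have h := hf.contDiffAt_fderiv_fderiv hz hz'
  let i := ContinuousLinearMap.inr ℝ E E
  have h1 : flatMetric f = fun z => (((fderiv ℝ (fderiv ℝ f) z).comp i).flip.comp i).flip := by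
    funext z; ext v w; rfl
  rw [h1]
  exact contDiffAt_flip ((contDiffAt_flip (h.clm_comp contDiffAt_const)).clm_comp contDiffAt_const)

lemma contDiffAt_flatForce (hf : IsFlatEnergy T f) (hz : z.1 ∈ T) (hz' : z.2 ≠ 0) :
    ContDiffAt ℝ ∞ (flatForce f) z :=
  ((hf.contDiffAt_fderiv hz hz').clm_comp contDiffAt_const).sub
    (((hf.contDiffAt_fderiv_fderiv hz hz').clm_apply (contDiffAt_snd.prodMk contDiffAt_const)).clm_comp contDiffAt_const)

lemma isInvertible_flatMetric [FiniteDimensional ℝ E] (hf : IsFlatEnergy T f) (hz : z.1 ∈ T) (hz' : z.2 ≠ 0) :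
    (flatMetric f z).IsInvertible := by
  have hinj : Function.Injective ((flatMetric f z) : E →ₗ[ℝ] E →L[ℝ] ℝ) := by
    rw [injective_iff_map_eq_zero]
    intro w hw
    refine hf.nondegenerate z hz hz' w fun v => ?_
    exact congrArg (fun L : E →L[ℝ] ℝ => L v) hw
  have hdim : finrank ℝ E = finrank ℝ (E →L[ℝ] ℝ) := by
    rw [← (LinearMap.toContinuousLinearMap (𝕜 := ℝ) (E := E) (F' := ℝ)).finrank_eq]
    exact (Subspace.dual_finrank_eq).symm
  let e := (LinearEquiv.ofInjectiveOfFinrankEq _ hinj hdim).toContinuousLinearEquiv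
  exact ⟨e, by ext v w; rfl⟩

lemma contDiffAt_flatSpray [FiniteDimensional ℝ E] (hf : IsFlatEnergy T f) (hz : z.1 ∈ T) (hz' : z.2 ≠ 0) :
    ContDiffAt ℝ ∞ (flatSpray f) z := by
  have h1 := (hf.isInvertible_flatMetric hz hz').contDiffAt_map_inverse (n := ∞)
  exact (h1.comp z (hf.contDiffAt_flatMetric hz hz')).clm_apply (hf.contDiffAt_flatForce hz hz')

/-- `flatSpray` is this equation solved for the acceleration by inverting the fibre Hessian. -/
lemma eulerLagrange [FiniteDimensional ℝ E] (hf : IsFlatEnergy T f) (hz : z.1 ∈ T) (hz' : z.2 ≠ 0) (a : E) :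
    fderiv ℝ (fderiv ℝ f) z (z.2, flatSpray f z) (0, a) = fderiv ℝ f z (a, 0) := by
  have h := congrArg (fun L : E →L[ℝ] ℝ => L a) ((hf.isInvertible_flatMetric hz hz').self_apply_inverse (flatForce f z))
  have h' : fderiv ℝ (fderiv ℝ f) z (0, flatSpray f z) (0, a) = fderiv ℝ f z (a, 0) - fderiv ℝ (fderiv ℝ f) z (z.2, 0) (0, a) := h
  have e : (z.2, flatSpray f z) = (z.2, (0 : E)) + (0, flatSpray f z) := by simp
  rw [e, map_add, add_apply, h']
  ring

lemma eq_flatSpray [FiniteDimensional ℝ E] (hf : IsFlatEnergy T f) (hz : z.1 ∈ T) (hz' : z.2 ≠ 0) {s : E}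
    (hs : ∀ a, fderiv ℝ (fderiv ℝ f) z (z.2, s) (0, a) = fderiv ℝ f z (a, 0)) : s = flatSpray f z := by
  refine sub_eq_zero.1 (hf.nondegenerate z hz hz' _ fun a => ?_)
  have e : ((0 : E), s - flatSpray f z) = (z.2, s) - (z.2, flatSpray f z) := by simp
  rw [e, map_sub, sub_apply, hs, hf.eulerLagrange hz hz', sub_self]

/-- The fundamental two-form `d d_J f` of a flat energy. -/
def _root_.Finsler.flatForm (f : E × E → ℝ) (z v w : E × E) : ℝ :=
  fderiv ℝ (fderiv ℝ f) z v (0, w.1) - fderiv ℝ (fderiv ℝ f) z w (0, v.1)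

lemma flatForm_flatSpray [FiniteDimensional ℝ E] (hf : IsFlatEnergy T f) (hz : z.1 ∈ T) (hz' : z.2 ≠ 0) (w : E × E) :
    flatForm f z (z.2, flatSpray f z) w = -fderiv ℝ f z w := by
  rw [flatForm, hf.eulerLagrange hz hz', hf.fderiv_fderiv_self hz hz']
  have : fderiv ℝ f z w = fderiv ℝ f z (w.1, 0) + fderiv ℝ f z (0, w.2) := by
    rw [← map_add]; simp
  rw [this]
  ring

/-- Vertical test vectors and Euler's relation force the base component to be `y`, by
non-degeneracy; test vectors `(a, 0)` then give the Euler–Lagrange equations. Hence the second-order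
property of the canonical spray is a consequence of its defining equation. -/
lemma eq_of_flatForm [FiniteDimensional ℝ E] (hf : IsFlatEnergy T f) (hz : z.1 ∈ T) (hz' : z.2 ≠ 0) {v : E × E}
    (hv : ∀ w, flatForm f z v w = -fderiv ℝ f z w) : v = (z.2, flatSpray f z) := by
  have h1 : v.1 = z.2 := by
    refine sub_eq_zero.1 (hf.nondegenerate z hz hz' _ fun a => ?_)
    have h2 := hv (0, a)
    have h3 := hf.fderiv_fderiv_self hz hz' (0, a)
    rw [flatForm] at h2
    simp only [← Prod.zero_eq_mk, map_zero, zero_sub, neg_inj] at h2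
    have e : ((0 : E), v.1 - z.2) = (0, v.1) - (0, z.2) := by simp
    rw [snd_symm (hf.contDiffAt z hz hz'), e, map_sub, h2, h3]
    ring
  refine Prod.ext h1 (hf.eq_flatSpray hz hz' fun a => ?_)
  have h2 := hv (a, 0)
  have h3 := hf.fderiv_fderiv_self hz hz' (a, 0)
  rw [flatForm, h1, h3] at h2
  simp only [← Prod.zero_eq_mk, map_zero, sub_zero] at h2
  rw [show (z.2, v.2) = v from Prod.ext h1.symm rfl]
  linarith

/-- The fibre dilation `μ` multiplies `f`, and so its pulled-back first and second derivatives, by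
`t²`. The rescaled coefficients therefore solve the Euler–Lagrange equations at the dilated point,
and solutions are unique. -/
lemma flatSpray_smul [FiniteDimensional ℝ E] (hf : IsFlatEnergy T f) (hz : z.1 ∈ T) (hz' : z.2 ≠ 0) {t : ℝ} (ht : 0 < t) :
    flatSpray f (z.1, t • z.2) = t ^ 2 • flatSpray f z := by
  let μ : E × E →L[ℝ] E × E := (ContinuousLinearMap.fst ℝ E E).prod (t • ContinuousLinearMap.snd ℝ E E)
  have hμ : ∀ y, μ y = (y.1, t • y.2) := fun y => rfl
  have ht' := ht.ne'
  have hμz : (μ z).2 ≠ 0 := smul_ne_zero ht' hz'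
  have h1 : ∀ {y : E × E}, y.1 ∈ T → y.2 ≠ 0 → (fderiv ℝ f (μ y)).comp μ = t ^ 2 • fderiv ℝ f y := by
    intro y hy hy'
    have h2 := ((hf.contDiffAt (μ y) hy (smul_ne_zero ht' hy')).differentiableAt (by simp)).hasFDerivAt.comp y μ.hasFDerivAt
    have h3 := ((hf.contDiffAt y hy hy').differentiableAt (by simp)).hasFDerivAt.const_mul (t ^ 2)
    refine h2.unique (h3.congr_of_eventuallyEq ?_)
    filter_upwards [hf.eventually hy hy'] with x hx
    exact hf.homogeneous x hx.1 t ht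
  have h4 : ∀ v w, fderiv ℝ (fderiv ℝ f) (μ z) (μ v) (μ w) = t ^ 2 * fderiv ℝ (fderiv ℝ f) z v w := by
    intro v w
    have h2 := (((hf.contDiffAt_fderiv (z := μ z) hz hμz).differentiableAt (by simp)).hasFDerivAt.comp z μ.hasFDerivAt).clm_apply (hasFDerivAt_const (μ w) z)
    have h3 := (((hf.contDiffAt_fderiv hz hz').differentiableAt (by simp)).hasFDerivAt.clm_apply (hasFDerivAt_const w z)).const_mul (t ^ 2)
    have h5 : (fun y => fderiv ℝ f (μ y) (μ w)) =ᶠ[𝓝 z] fun y => t ^ 2 * fderiv ℝ f y w := by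
      filter_upwards [hf.eventually hz hz'] with x hx
      exact congrArg (fun L : E × E →L[ℝ] ℝ => L w) (h1 hx.1 hx.2)
    have h6 := congrArg (fun L : E × E →L[ℝ] ℝ => L v) (h2.unique (h3.congr_of_eventuallyEq h5))
    simpa using h6
  symm
  refine hf.eq_flatSpray (z := (z.1, t • z.2)) hz hμz fun a => ?_
  have e1 : ((z.1, t • z.2).2, t ^ 2 • flatSpray f z) = t • μ (z.2, flatSpray f z) := by
    simp [hμ, smul_smul, sq]
  have e2 : ((0 : E), a) = t⁻¹ • μ (0, a) := by simp [hμ, smul_smul, ht']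
  have e3 := congrArg (fun L : E × E →L[ℝ] ℝ => L (a, 0)) (h1 hz hz')
  simp only [ContinuousLinearMap.comp_apply, hμ, smul_zero, smul_apply, smul_eq_mul] at e3
  rw [e1, e2, map_smul, map_smul, smul_apply, ← hμ, h4, hf.eulerLagrange hz hz', hμ, e3]
  simp only [smul_eq_mul]
  field_simp

lemma fderiv_flatSpray_self [FiniteDimensional ℝ E] (hf : IsFlatEnergy T f) (hz : z.1 ∈ T) (hz' : z.2 ≠ 0) :
    fderiv ℝ (flatSpray f) z (0, z.2) = (2 : ℝ) • flatSpray f z := by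
  have h1 : HasDerivAt (fun t : ℝ => (z.1, t • z.2)) ((0 : E), (1 : ℝ) • z.2) 1 :=
    (hasDerivAt_const (1 : ℝ) z.1).prodMk ((hasDerivAt_id (1 : ℝ)).smul_const z.2)
  have h0 : (fun t : ℝ => (z.1, t • z.2)) 1 = z := by simp
  have hd := ((hf.contDiffAt_flatSpray hz hz').differentiableAt (by simp)).hasFDerivAt
  rw [← h0] at hd
  have h2 := hd.comp_hasDerivAt (1 : ℝ) h1
  have h3 : HasDerivAt (fun t : ℝ => t ^ 2 • flatSpray f z) ((2 : ℝ) • flatSpray f z) 1 := by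
    simpa using (hasDerivAt_pow 2 (1 : ℝ)).smul_const (flatSpray f z)
  have h4 : (flatSpray f ∘ fun t : ℝ => (z.1, t • z.2)) =ᶠ[𝓝 1] fun t : ℝ => t ^ 2 • flatSpray f z := by
    filter_upwards [lt_mem_nhds (zero_lt_one : (0 : ℝ) < 1)] with t ht
    exact hf.flatSpray_smul hz hz' ht
  have h5 := h2.unique (h3.congr_of_eventuallyEq h4)
  simpa using h5

/-- Euler–Lagrange in the direction `y`, with Euler's relation, says `S f = 0`. Differentiating this
in the fibre direction `b` and using Euler–Lagrange once more gives twice the claim. -/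
lemma fderiv_hor [FiniteDimensional ℝ E] (hf : IsFlatEnergy T f) (hz : z.1 ∈ T) (hz' : z.2 ≠ 0) (b : E) :
    fderiv ℝ f z (b, flatConn (flatSpray f) z b) = 0 := by
  have h1 : ∀ {y : E × E}, y.1 ∈ T → y.2 ≠ 0 → fderiv ℝ f y (y.2, flatSpray f y) = 0 := by
    intro y hy hy'
    have h2 := hf.eulerLagrange hy hy' y.2
    rw [hf.fderiv_fderiv_self hy hy'] at h2
    have h3 : fderiv ℝ f y (y.2, flatSpray f y) = fderiv ℝ f y (y.2, 0) + fderiv ℝ f y (0, flatSpray f y) := by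
      rw [← map_add]; simp
    simp only at h2
    linarith
  have h2 := ((hf.contDiffAt_fderiv hz hz').differentiableAt (by simp)).hasFDerivAt.clm_apply
    ((hasFDerivAt_snd (𝕜 := ℝ) (p := z)).prodMk ((hf.contDiffAt_flatSpray hz hz').differentiableAt (by simp)).hasFDerivAt)
  have h3 : (fun y : E × E => fderiv ℝ f y (y.2, flatSpray f y)) =ᶠ[𝓝 z] fun _ => 0 := by
    filter_upwards [hf.eventually hz hz'] with y hy
    exact h1 hy.1 hy.2
  have h4 := congrArg (fun L : E × E →L[ℝ] ℝ => L (0, b)) (h2.unique ((hasFDerivAt_const (0 : ℝ) z).congr_of_eventuallyEq h3))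
  simp only [add_apply, ContinuousLinearMap.comp_apply, ContinuousLinearMap.flip_apply, ContinuousLinearMap.prod_apply, zero_apply, ContinuousLinearMap.coe_snd'] at h4
  rw [snd_symm (hf.contDiffAt z hz hz'), hf.eulerLagrange hz hz'] at h4
  have e : (b, flatConn (flatSpray f) z b) = (1 / 2 : ℝ) • ((2 : ℝ) • (b, (0 : E)) + (0, 0) + (0, fderiv ℝ (flatSpray f) z (0, b))) := by
    simp [flatConn_apply, smul_smul]
  have e2 : (b, fderiv ℝ (flatSpray f) z (0, b)) = (b, (0 : E)) + (0, fderiv ℝ (flatSpray f) z (0, b)) := by simp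
  rw [e2, map_add] at h4
  rw [e, map_smul, map_add, map_add, map_smul, ← Prod.zero_eq_mk, map_zero, smul_eq_mul, smul_eq_mul]
  linarith

/-- Fields that annihilate `f` have brackets that annihilate `f`. Concretely, `fderiv_hor` is
differentiated along a horizontal vector and skew-symmetrized; the Hessian term is symmetric and
disappears. -/
lemma fderiv_flatCurv [FiniteDimensional ℝ E] (hf : IsFlatEnergy T f) (hz : z.1 ∈ T) (hz' : z.2 ≠ 0) (a b : E) :
    fderiv ℝ f z (0, flatCurv (flatSpray f) z a b) = 0 := by
  have hN := (contDiffAt_flatConn (hf.contDiffAt_flatSpray hz hz')).differentiableAt (by simp)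
  have key : ∀ a b : E, fderiv ℝ (fderiv ℝ f) z (a, flatConn (flatSpray f) z a) (b, flatConn (flatSpray f) z b) +
      fderiv ℝ f z (0, fderiv ℝ (flatConn (flatSpray f)) z (a, flatConn (flatSpray f) z a) b) = 0 := by
    intro a b
    have h2 := ((hf.contDiffAt_fderiv hz hz').differentiableAt (by simp)).hasFDerivAt.clm_apply
      ((hasFDerivAt_const b z).prodMk (hN.hasFDerivAt.clm_apply (hasFDerivAt_const b z)))
    have h3 : (fun y : E × E => fderiv ℝ f y (b, flatConn (flatSpray f) y b)) =ᶠ[𝓝 z] fun _ => 0 := by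
      filter_upwards [hf.eventually hz hz'] with y hy
      exact hf.fderiv_hor hy.1 hy.2 b
    have h4 := congrArg (fun L : E × E →L[ℝ] ℝ => L (a, flatConn (flatSpray f) z a)) (h2.unique ((hasFDerivAt_const (0 : ℝ) z).congr_of_eventuallyEq h3))
    simp at h4
    linarith
  have h1 := key a b
  have h2 := key b a
  rw [snd_symm (hf.contDiffAt z hz hz')] at h2
  have e : ((0 : E), flatCurv (flatSpray f) z a b) = (0, fderiv ℝ (flatConn (flatSpray f)) z (b, flatConn (flatSpray f) z b) a) -
     (0, fderiv ℝ (flatConn (flatSpray f)) z (a, flatConn (flatSpray f) z a) b) := by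
    simp [flatCurv_apply]
  rw [e, map_sub]
  linarith

end IsFlatEnergy
end FlatEnergy

/-! ### The canonical spray: existence, uniqueness, homogeneity -/

section CanonicalSpray
variable {E : Type*} [NormedAddCommGroup E] [NormedSpace ℝ E]
  {M : Type*} [TopologicalSpace M] [ChartedSpace E M] [IsManifold 𝓘(ℝ, E) ∞ M]

attribute [local instance] isManifold_one

variable {F : TM E M → ℝ} {c : M} {u : TM E M}

/-- The local representative of the energy function. -/
def energyRep (c : M) (F : TM E M → ℝ) (z : E × E) : ℝ := energy F ((chart E c).symm z)

lemma IsFinslerFunction.contMDiffAt (hF : IsFinslerFunction F) (hu : u ∈ slit E M) :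
    ContMDiffAt (modelTM E) 𝓘(ℝ, ℝ) ∞ F u := ContMDiffOn.contMDiffAt hF.smooth (slit_mem_nhds hu)

lemma IsFinslerFunction.contMDiffAt_energy (hF : IsFinslerFunction F) (hu : u ∈ slit E M) :
    ContMDiffAt (modelTM E) 𝓘(ℝ, ℝ) ∞ (energy F) u :=
  contMDiffAt_const.mul ((hF.contMDiffAt hu).pow 2)

lemma IsFinslerFunction.contDiffAt_energyRep (hF : IsFinslerFunction F) (hu : u ∈ slit E M)
    (h : u.proj ∈ (chartAt E c).source) : ContDiffAt ℝ ∞ (energyRep c F) (chart E c u) :=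
  (contMDiffAt_iff_contDiffAt_chart h _).1 (hF.contMDiffAt_energy hu)

lemma chart_symm_mem_slit {z : E × E} (hz : z ∈ (chart E c).target) :
    (chart E c).symm z ∈ slit E M ↔ z.2 ≠ 0 := by
  rw [mem_slit_iff (chart_symm_mem hz), (chart E c).right_inv hz]

lemma chart_symm_smul {z : E × E} (hz : z ∈ (chart E c).target) (t : ℝ) :
    (chart E c).symm (z.1, t • z.2) = ⟨((chart E c).symm z).proj, t • ((chart E c).symm z).2⟩ := by
  set u := (chart E c).symm z with hu
  have h : u.proj ∈ (chartAt E c).source := chart_symm_mem hz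
  have h1 := chart_apply (c := c) (u := (⟨u.proj, t • u.2⟩ : TM E M)) h
  have h2 := chart_apply h
  rw [hu, (chart E c).right_inv hz, ← hu] at h2
  have h3 : chart E c (⟨u.proj, t • u.2⟩ : TM E M) = (z.1, t • z.2) := by
    rw [h1, h2]
    exact Prod.ext rfl ((baseRep c u.proj).map_smul t u.2)
  rw [← h3]
  exact chart_left_inv (u := (⟨u.proj, t • u.2⟩ : TM E M)) h

lemma IsFinslerFunction.vDiff_sq_eq (hF : IsFinslerFunction F) (hu : u ∈ slit E M)
    (h : u.proj ∈ (chartAt E c).source) (w : TangentSpace 𝓘(ℝ, E) u.proj) :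
    vDiff (fun v => F v ^ 2) u w = 2 * fderiv ℝ (energyRep c F) (chart E c u) (0, baseRep c u.proj w) := by
  have h1 : ContMDiffAt (modelTM E) 𝓘(ℝ, ℝ) ∞ (fun v => F v ^ 2) u := (hF.contMDiffAt hu).pow 2
  have h2 : (fun z => F ((chart E c).symm z) ^ 2) = fun z => 2 * energyRep c F z := by
    funext z; rw [energyRep, energy]; ring
  rw [vDiff, ContinuousLinearMap.comp_apply, dTM_eq h h1, tmRep_iMap h, h2,
    fderiv_const_mul ((hF.contDiffAt_energyRep hu h).differentiableAt (by simp))]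
  simp

lemma IsFinslerFunction.metric_eq (hF : IsFinslerFunction F) (hu : u ∈ slit E M)
    (h : u.proj ∈ (chartAt E c).source) (w v : TangentSpace 𝓘(ℝ, E) u.proj) :
    metric F u w v = flatMetric (energyRep c F) (chart E c u) (baseRep c u.proj w) (baseRep c u.proj v) := by
  let A : E →L[ℝ] E := baseRep c u.proj
  let x := extChartAt 𝓘(ℝ, E) c u.proj
  have hA : (x, A (fibreVec u)) = chart E c u := (chart_apply h).symm
  have hne : fibreVec u ≠ 0 := hu
  have e : (fun y : E => vDiff (fun v => F v ^ 2) (fibreIncl u.proj y) v) =ᶠ[𝓝 (fibreVec u)]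
      fun y => 2 * fderiv ℝ (energyRep c F) (x, A y) (0, A v) := by
    filter_upwards [isOpen_ne.mem_nhds hne] with y hy
    have h1 := hF.vDiff_sq_eq (u := fibreIncl u.proj y) hy h v
    rw [fibreIncl_chart h] at h1
    exact h1
  have h2 : ContDiffAt ℝ ∞ (fderiv ℝ (energyRep c F)) (x, A (fibreVec u)) := by
    rw [hA]
    exact (hF.contDiffAt_energyRep hu h).fderiv_right (m := ∞) (by simp)
  have h3 : HasFDerivAt (fun y : E => (x, A y)) ((0 : E →L[ℝ] E).prod A) (fibreVec u) :=
    (hasFDerivAt_const _ _).prodMk A.hasFDerivAt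
  have h4 := ((((h2.differentiableAt (by simp)).hasFDerivAt).comp (fibreVec u) h3).clm_apply
    (hasFDerivAt_const ((0 : E), A v) (fibreVec u))).const_mul 2
  have h5 := h4.congr_of_eventuallyEq e
  rw [metric, h5.fderiv, hA]
  have h6 : ∀ w : E, (1 / 2 : ℝ) * ((2 : ℝ) • ((((fderiv ℝ (energyRep c F) (x, A (fibreVec u))).comp
      (0 : E →L[ℝ] E × E)) + (((fderiv ℝ (fderiv ℝ (energyRep c F)) (chart E c u)).comp ((0 : E →L[ℝ] E).prod A)).flip ((0 : E), A v))))) w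
      = flatMetric (energyRep c F) (chart E c u) (A w) (A v) := by
    intro w
    simp [flatMetric_apply]
  exact h6 w

lemma IsFinslerFunction.isFlatEnergy (hF : IsFinslerFunction F) (c : M) :
    IsFlatEnergy (extChartAt 𝓘(ℝ, E) c).target (energyRep c F) where
  isOpen := isOpen_extChartAt_target c
  contDiffAt z hz hz' := by
    have hz := mem_chart_target_iff'.2 hz
    have := hF.contDiffAt_energyRep ((chart_symm_mem_slit hz).2 hz') (chart_symm_mem hz)
    rwa [(chart E c).right_inv hz] at this
  homogeneous z hz t ht := by
    have hz := mem_chart_target_iff'.2 hz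
    rw [energyRep, energyRep, chart_symm_smul hz, energy, energy, hF.homogeneous _ _ _ ht.le]
    ring
  nondegenerate z hz hz' w hw := by
    have hz := mem_chart_target_iff'.2 hz
    have hu := (chart_symm_mem_slit hz).2 hz'
    have h := chart_symm_mem hz
    obtain ⟨e, he⟩ := isInvertible_baseRep (E := E) h
    have h1 : e.symm w = 0 := hF.nondegenerate _ hu _ fun v => by
      rw [hF.metric_eq hu h, (chart E c).right_inv hz, ← he]
      rw [show (e : TangentSpace 𝓘(ℝ, E) _ →L[ℝ] E) (e.symm w) = w from e.apply_symm_apply w]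
      exact hw _
    rw [← e.apply_symm_apply w, h1, map_zero]

lemma smoothVF_completeLift [FiniteDimensional ℝ E] [T2Space M] {X : ∀ p : M, TangentSpace 𝓘(ℝ, E) p}
    (hX : SmoothBaseVF X) (U : Set (TM E M)) : SmoothVF U (completeLift X) := by
  intro u _
  have h := mem_chart_source E u.proj
  have hz1 : (chart E u.proj u).1 = extChartAt 𝓘(ℝ, E) u.proj u.proj := congrArg Prod.fst (chart_apply h)
  have hXd := hX.contDiffAt h
  rw [← hz1] at hXd
  refine ContMDiffAt.contMDiffWithinAt ((contMDiffAt_vf_iff_vfRep h _).2 ?_)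
  have h1 : ContDiffAt ℝ ∞ (fun z : E × E => (baseVFRep u.proj X z.1, fderiv ℝ (baseVFRep u.proj X) z.1 z.2)) (chart E u.proj u) :=
    (hXd.comp _ contDiffAt_fst).prodMk
      (((hXd.fderiv_right (m := ∞) (by simp)).comp _ contDiffAt_fst).clm_apply contDiffAt_snd)
  refine h1.congr_of_eventuallyEq ?_
  filter_upwards [(isOpen_chart_target _).mem_nhds (chart_mem_target h)] with z hz
  have := tmRep_completeLift hX (chart_symm_mem hz)
  rwa [(chart E u.proj).right_inv hz] at this

lemma smoothVF_iSec_basic {X : ∀ p : M, TangentSpace 𝓘(ℝ, E) p}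
    (hX : SmoothBaseVF X) (U : Set (TM E M)) : SmoothVF U (iSec (basic X)) := by
  intro u _
  have h := mem_chart_source E u.proj
  have hz1 : (chart E u.proj u).1 = extChartAt 𝓘(ℝ, E) u.proj u.proj := congrArg Prod.fst (chart_apply h)
  have hXd := hX.contDiffAt h
  rw [← hz1] at hXd
  refine ContMDiffAt.contMDiffWithinAt ((contMDiffAt_vf_iff_vfRep h _).2 ?_)
  have h1 : ContDiffAt ℝ ∞ (fun z : E × E => ((0 : E), baseVFRep u.proj X z.1)) (chart E u.proj u) :=
    contDiffAt_const.prodMk (hXd.comp _ contDiffAt_fst)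
  refine h1.congr_of_eventuallyEq ?_
  filter_upwards [(isOpen_chart_target _).mem_nhds (chart_mem_target h)] with z hz
  rw [vfRep, iSec, tmRep_iMap (chart_symm_mem hz)]
  exact congrArg _ (secRep_basic X hz)

lemma SmoothVF.add {U : Set (TM E M)} (hU : IsOpen U) {ξ η : VF E M} (hξ : SmoothVF U ξ) (hη : SmoothVF U η) :
    SmoothVF U (fun u => ξ u + η u) := by
  intro u hu
  have h := mem_chart_source E u.proj
  have hU' := hU.mem_nhds hu
  refine ContMDiffAt.contMDiffWithinAt ((contMDiffAt_vf_iff_vfRep h _).2 ?_)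
  refine ((SmoothVF.contDiffAt hξ hU' h).add (SmoothVF.contDiffAt hη hU' h)).congr_of_eventuallyEq (.of_forall fun z => ?_)
  exact map_add _ _ _

/-- Complete and vertical lifts together span the tangent spaces of `TM`. This turns the equation
for `S`, stated for vector fields, into a pointwise one. -/
lemma exists_smoothVF_eq [FiniteDimensional ℝ E] [T2Space M] (u : TM E M) (v : TangentSpace (modelTM E) u) :
    ∃ ξ : VF E M, SmoothVF (slit E M) ξ ∧ ξ u = v := by
  have h := mem_chart_source E u.proj
  obtain ⟨X, hX, hXu⟩ := exists_smoothBaseVF_eq u.proj (jMap u v)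
  obtain ⟨w, hw⟩ : ∃ w : TangentSpace 𝓘(ℝ, E) u.proj, baseRep u.proj u.proj w = (tmRep u.proj u (v - completeLift X u)).2 :=
    ⟨_, (isInvertible_baseRep h).self_apply_inverse _⟩
  obtain ⟨Y, hY, hYu⟩ := exists_smoothBaseVF_eq u.proj w
  refine ⟨_, SmoothVF.add (isOpen_slit E M) (smoothVF_completeLift hX _) (smoothVF_iSec_basic hY _), ?_⟩
  apply (isInvertible_tmRep h).injective
  have h1 : tmRep u.proj u (iSec (basic Y) u) = tmRep u.proj u (v - completeLift X u) := by
    rw [iSec, tmRep_iMap h, basic, hYu, hw]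
    refine Prod.ext ?_ rfl
    have hz1 : (chart E u.proj u).1 = extChartAt 𝓘(ℝ, E) u.proj u.proj := congrArg Prod.fst (chart_apply h)
    rw [map_sub, Prod.fst_sub, ← baseRep_jMap h v, ← hXu, tmRep_completeLift hX h, hz1, baseVFRep, extChartAt_left_inv' h, sub_self]
  rw [map_add, h1, map_sub, add_sub_cancel]

lemma IsFinslerFunction.dTM_energy (hF : IsFinslerFunction F) (hu : u ∈ slit E M)
    (h : u.proj ∈ (chartAt E c).source) (v : TangentSpace (modelTM E) u) :
    dTM (energy F) u v = fderiv ℝ (energyRep c F) (chart E c u) (tmRep c u v) :=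
  dTM_eq h (hF.contMDiffAt_energy hu) v

lemma tmRep_vertEnd (h : u.proj ∈ (chartAt E c).source) (ξ : VF E M) :
    tmRep c u (vertEnd ξ u) = (0, (tmRep c u (ξ u)).1) := by
  rw [vertEnd, tmRep_iMap h, baseRep_jMap h]

/-- The derivatives of `ξ` and `η` in the first two terms of `ddJ` cancel against the bracket term,
leaving an expression in their values at `u`. -/
lemma IsFinslerFunction.ddJ_energy [CompleteSpace E] (hF : IsFinslerFunction F) (hu : u ∈ slit E M)
    (h : u.proj ∈ (chartAt E c).source) {ξ η : VF E M} (hξ : ContDiffAt ℝ ∞ (vfRep c ξ) (chart E c u))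
    (hη : ContDiffAt ℝ ∞ (vfRep c η) (chart E c u)) :
    ddJ (energy F) ξ η u = flatForm (energyRep c F) (chart E c u) (tmRep c u (ξ u)) (tmRep c u (η u)) := by
  set z := chart E c u with hz
  have hfd := hF.contDiffAt_energyRep hu h
  have hfd' : ContDiffAt ℝ ∞ (fderiv ℝ (energyRep c F)) z := hfd.fderiv_right (m := ∞) (by simp)
  have key : ∀ {ζ : VF E M}, ContDiffAt ℝ ∞ (vfRep c ζ) z → ∀ v, dTM (dJ (energy F) ζ) u v =
      fderiv ℝ (fderiv ℝ (energyRep c F)) z (tmRep c u v) (0, (tmRep c u (ζ u)).1) +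
      fderiv ℝ (energyRep c F) z (0, (fderiv ℝ (vfRep c ζ) z (tmRep c u v)).1) := by
    intro ζ hζ v
    have e : (fun y => dJ (energy F) ζ ((chart E c).symm y)) =ᶠ[𝓝 z] fun y => fderiv ℝ (energyRep c F) y (0, (vfRep c ζ y).1) := by
      filter_upwards [eventually_chart h (slit_mem_nhds hu)] with y hy
      rw [dJ, hF.dTM_energy hy.2 (chart_symm_mem hy.1), tmRep_vertEnd (chart_symm_mem hy.1), (chart E c).right_inv hy.1]
      rfl
    have h0 : ContDiffAt ℝ ∞ (fun y => ((0 : E), (vfRep c ζ y).1)) z := contDiffAt_const.prodMk hζ.fst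
    have h1 := (hfd'.clm_apply h0).congr_of_eventuallyEq e
    rw [dTM_eq h ((contMDiffAt_iff_contDiffAt_chart h _).2 h1), ← hz, e.fderiv_eq, fderiv_clm_apply (hfd'.differentiableAt (by simp)) (h0.differentiableAt (by simp)),
      ((hasFDerivAt_const (0 : E) z).prodMk (hζ.differentiableAt (by simp)).hasFDerivAt.fst).fderiv, ← vfRep_chart h, ← hz]
    simp [add_comm]
  have h1 : dJ (energy F) (bracket ξ η) u = fderiv ℝ (energyRep c F) z (0, (fderiv ℝ (vfRep c η) z (tmRep c u (ξ u))).1) -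
      fderiv ℝ (energyRep c F) z (0, (fderiv ℝ (vfRep c ξ) z (tmRep c u (η u))).1) := by
    rw [dJ, hF.dTM_energy hu h, tmRep_vertEnd h, tmRep_bracket h hξ hη, VectorField.lieBracket, ← vfRep_chart h, ← vfRep_chart h, ← hz, ← map_sub]
    simp
  rw [ddJ, key hη, key hξ, h1, flatForm]
  ring

variable [FiniteDimensional ℝ E] [T2Space M]

/-- A vector satisfies the defining equation of the canonical spray in some chart if and only if it does so in
every chart. -/
lemma IsFinslerFunction.tmRep_eq_iff (hF : IsFinslerFunction F) (hu : u ∈ slit E M)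
    (h : u.proj ∈ (chartAt E c).source) (v : TangentSpace (modelTM E) u) :
    tmRep c u v = ((chart E c u).2, flatSpray (energyRep c F) (chart E c u)) ↔
      ∃ ξ : VF E M, SmoothVF (slit E M) ξ ∧ ξ u = v ∧
      ∀ η : VF E M, SmoothVF (slit E M) η → ddJ (energy F) ξ η u = -dTM (energy F) u (η u) := by
  have hz := mem_chart_target_iff'.1 (chart_mem_target h)
  have hz' := (mem_slit_iff h).1 hu
  have hE := hF.isFlatEnergy c
  constructor
  · intro hv
    obtain ⟨ξ, hξ, rfl⟩ := exists_smoothVF_eq u v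
    refine ⟨ξ, hξ, rfl, fun η hη => ?_⟩
    rw [hF.ddJ_energy hu h (SmoothVF.contDiffAt hξ (slit_mem_nhds hu) h) (SmoothVF.contDiffAt hη (slit_mem_nhds hu) h), hv,
      hE.flatForm_flatSpray hz hz', hF.dTM_energy hu h]
  · rintro ⟨ξ, hξ, rfl, heq⟩
    refine hE.eq_of_flatForm hz hz' fun w => ?_
    obtain ⟨w, rfl⟩ : ∃ w', tmRep c u w' = w := ⟨_, (isInvertible_tmRep h).self_apply_inverse w⟩
    obtain ⟨η, hη, rfl⟩ := exists_smoothVF_eq u w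
    rw [← hF.ddJ_energy hu h (SmoothVF.contDiffAt hξ (slit_mem_nhds hu) h) (SmoothVF.contDiffAt hη (slit_mem_nhds hu) h),
      heq η hη, hF.dTM_energy hu h]

open Classical in
lemma IsFinslerFunction.exists_canonicalSpray (hF : IsFinslerFunction F) :
    ∃ S : VF E M, (∀ u, u ∉ slit E M → S u = 0) ∧ SmoothVF (slit E M) S ∧
    ∀ ξ : VF E M, SmoothVF (slit E M) ξ → ∀ u ∈ slit E M,
      ddJ (energy F) S ξ u = -dTM (energy F) u (ξ u) := by
  -- At each point the preferred chart is used. The right-hand side of `tmRep_eq_iff` mentions no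
  -- chart, so the same formula holds in every chart, which makes the field smooth.
  let S : VF E M := fun u => if u ∈ slit E M then (tmRep u.proj u).inverse
    ((chart E u.proj u).2, flatSpray (energyRep u.proj F) (chart E u.proj u)) else 0
  have hS : ∀ {u : TM E M}, u ∈ slit E M → ∀ {c : M}, u.proj ∈ (chartAt E c).source →
      tmRep c u (S u) = ((chart E c u).2, flatSpray (energyRep c F) (chart E c u)) := by
    intro u hu c h
    have h' := mem_chart_source E u.proj
    refine (hF.tmRep_eq_iff hu h _).2 ((hF.tmRep_eq_iff hu h' _).1 ?_)
    rw [show S u = _ from if_pos hu]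
    exact (isInvertible_tmRep h').self_apply_inverse _
  have hsm : SmoothVF (slit E M) S := by
    intro u hu
    have h := mem_chart_source E u.proj
    refine ContMDiffAt.contMDiffWithinAt ((contMDiffAt_vf_iff_vfRep h _).2 ?_)
    have h1 := (hF.isFlatEnergy u.proj).contDiffAt_flatSpray (mem_chart_target_iff'.1 (chart_mem_target h)) ((mem_slit_iff h).1 hu)
    refine (contDiffAt_snd.prodMk h1).congr_of_eventuallyEq ?_
    filter_upwards [eventually_chart h (slit_mem_nhds hu)] with z hz
    have := hS hz.2 (chart_symm_mem hz.1)
    rwa [(chart E u.proj).right_inv hz.1] at this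
  refine ⟨S, fun u hu => if_neg hu, hsm, fun ξ hξ u hu => ?_⟩
  have h := mem_chart_source E u.proj
  rw [hF.ddJ_energy hu h (SmoothVF.contDiffAt hsm (slit_mem_nhds hu) h) (SmoothVF.contDiffAt hξ (slit_mem_nhds hu) h), hS hu h,
    (hF.isFlatEnergy u.proj).flatForm_flatSpray (mem_chart_target_iff'.1 (chart_mem_target h)) ((mem_slit_iff h).1 hu), hF.dTM_energy hu h]

lemma IsFinslerFunction.tmRep_canonicalSpray (hF : IsFinslerFunction F) (hu : u ∈ slit E M)
    (h : u.proj ∈ (chartAt E c).source) :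
    tmRep c u (canonicalSpray F u) = ((chart E c u).2, flatSpray (energyRep c F) (chart E c u)) := by
  have hspec : _ ∧ SmoothVF (slit E M) (canonicalSpray F) ∧ _ := Classical.epsilon_spec hF.exists_canonicalSpray
  exact (hF.tmRep_eq_iff hu h _).2 ⟨_, hspec.2.1, rfl, fun η hη => hspec.2.2 η hη u hu⟩

lemma IsFinslerFunction.sprayCoeff_canonicalSpray (hF : IsFinslerFunction F) (hu : u ∈ slit E M)
    (h : u.proj ∈ (chartAt E c).source) :
    sprayCoeff c (canonicalSpray F) =ᶠ[𝓝 (chart E c u)] flatSpray (energyRep c F) := by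
  filter_upwards [eventually_chart h (slit_mem_nhds hu)] with z hz
  have := hF.tmRep_canonicalSpray hz.2 (chart_symm_mem hz.1)
  rw [(chart E c).right_inv hz.1] at this
  exact congrArg Prod.snd this

/-- The canonical spray of a Finsler function is a spray. -/
theorem IsFinslerFunction.isSpray (hF : IsFinslerFunction F) : IsSpray (canonicalSpray F) where
  smooth := (Classical.epsilon_spec hF.exists_canonicalSpray).2.1
  secondOrder u hu := by
    have h := mem_chart_source E u.proj
    apply (isInvertible_baseRep h).injective
    rw [baseRep_jMap h, hF.tmRep_canonicalSpray hu h, baseRep_delta h]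
  homogeneous u hu c h := by
    have e := hF.sprayCoeff_canonicalSpray hu h
    rw [e.fderiv_eq, e.eq_of_nhds]
    exact (hF.isFlatEnergy c).fderiv_flatSpray_self (mem_chart_target_iff'.1 (chart_mem_target h)) ((mem_slit_iff h).1 hu)

end CanonicalSpray

/-! ### Positivity of the metric on normals when the energy is positive -/

section PositiveDefinite
variable {E : Type*} [NormedAddCommGroup E] [NormedSpace ℝ E]

/-- A negative second derivative would make the minimum also a local maximum, so `D` would be
locally constant with zero second derivative. -/
lemma nonneg_of_isLocalMin {D D₁ : ℝ → ℝ} {d : ℝ} (hmin : IsLocalMin D 0) (h1 : ∀ᶠ t in 𝓝 0, HasDerivAt D (D₁ t) t)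
    (h2 : HasDerivAt D₁ d 0) : 0 ≤ d := by
  by_contra! hd
  have e : deriv D =ᶠ[𝓝 0] D₁ := h1.mono fun t ht => ht.deriv
  have hdd : deriv (deriv D) 0 = d := e.deriv_eq.trans h2.deriv
  have hmax := isLocalMax_of_deriv_deriv_neg (hdd ▸ hd) hmin.deriv_eq_zero h1.self_of_nhds.continuousAt
  have hc : D =ᶠ[𝓝 0] fun _ => D 0 := by
    filter_upwards [hmin, hmax] with t ht ht'
    exact le_antisymm ht' ht
  have hc' : deriv D =ᶠ[𝓝 0] fun _ => 0 := hc.deriv.trans (by simp)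
  rw [hc'.deriv_eq, deriv_const] at hdd
  exact hd.ne hdd.symm

/-- A vector in the kernel of the fibre derivative of `f`, with respect to a basis of the plane `E`. -/
def flatNormal (e : Basis (Fin 2) ℝ E) (f : E × E → ℝ) (z : E × E) : E :=
  fderiv ℝ f z (0, e 1) • e 0 - fderiv ℝ f z (0, e 0) • e 1

namespace IsFlatEnergy
variable {T : Set E} {f : E × E → ℝ} {z : E × E} {e : Basis (Fin 2) ℝ E}

lemma contDiffAt_flatNormal (hf : IsFlatEnergy T f) (hz : z.1 ∈ T) (hz' : z.2 ≠ 0) :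
    ContDiffAt ℝ ∞ (flatNormal e f) z := by
  have h := hf.contDiffAt_fderiv hz hz'
  exact ((h.clm_apply contDiffAt_const).smul contDiffAt_const).sub ((h.clm_apply contDiffAt_const).smul contDiffAt_const)

lemma _root_.Finsler.fderiv_inr_apply (e : Basis (Fin 2) ℝ E) (f : E × E → ℝ) (z : E × E) (v : E) :
    fderiv ℝ f z (0, v) = e.repr v 0 * fderiv ℝ f z (0, e 0) + e.repr v 1 * fderiv ℝ f z (0, e 1) := by
  have h : (fderiv ℝ f z).comp (ContinuousLinearMap.inr ℝ E E) v =
      (fderiv ℝ f z).comp (ContinuousLinearMap.inr ℝ E E) (∑ i, e.repr v i • e i) := by rw [e.sum_repr]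
  rw [map_sum, Fin.sum_univ_two, map_smul, map_smul] at h
  exact h

lemma _root_.Finsler.fderiv_flatNormal (e : Basis (Fin 2) ℝ E) (f : E × E → ℝ) (z : E × E) :
    fderiv ℝ f z (0, flatNormal e f z) = 0 := by
  rw [fderiv_inr_apply e, flatNormal]
  simp
  ring

/-- Otherwise the fibre derivative of `f` vanishes, against Euler's relation and `0 < f z`. -/
lemma flatNormal_ne_zero (hf : IsFlatEnergy T f) (hz : z.1 ∈ T) (hz' : z.2 ≠ 0) (hpos : 0 < f z) :
    flatNormal e f z ≠ 0 := by
  intro h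
  have h0 := congrArg (fun v => e.repr v 0) h
  have h1 := congrArg (fun v => e.repr v 1) h
  simp [flatNormal] at h0 h1
  have h2 := hf.fderiv_self hz hz'
  rw [fderiv_inr_apply e, h0, h1] at h2
  linarith

/-- The normal `n` is orthogonal to `y`. Were it null, it would be orthogonal to the span of `y` and
`n`, which is the whole plane, against non-degeneracy. -/
lemma flatMetric_flatNormal_ne_zero (hf : IsFlatEnergy T f) (hz : z.1 ∈ T) (hz' : z.2 ≠ 0) (hpos : 0 < f z) :
    flatMetric f z (flatNormal e f z) (flatNormal e f z) ≠ 0 := by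
  intro h
  refine hf.flatNormal_ne_zero (e := e) hz hz' hpos (hf.nondegenerate z hz hz' _ fun v => ?_)
  rw [← flatMetric_apply]
  set n := flatNormal e f z with hn
  have hny : flatMetric f z n z.2 = 0 := by rw [hf.flatMetric_self hz hz', fderiv_flatNormal]
  set p := fderiv ℝ f z (0, e 0) with hp
  set q := fderiv ℝ f z (0, e 1) with hq
  have hpq : p ^ 2 + q ^ 2 ≠ 0 := by
    intro h0
    have hp0 : p = 0 := by nlinarith [sq_nonneg p, sq_nonneg q]
    have hq0 : q = 0 := by nlinarith [sq_nonneg p, sq_nonneg q]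
    have h2 := hf.fderiv_self hz hz'
    rw [fderiv_inr_apply e, ← hp, ← hq, hp0, hq0] at h2
    linarith
  have hy : e.repr z.2 0 * p + e.repr z.2 1 * q = 2 * f z := by
    rw [hp, hq, ← fderiv_inr_apply e, hf.fderiv_self hz hz']
  -- The expansion of `v` in `y` and `n`, cleared of its denominators `p² + q²` and `2 f`.
  have hv : (p ^ 2 + q ^ 2) • (2 * f z) • v = ((p ^ 2 + q ^ 2) * (e.repr v 0 * p + e.repr v 1 * q)) • z.2 +
      ((e.repr z.2 0 * p + e.repr z.2 1 * q) * (e.repr v 0 * q - e.repr v 1 * p) -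
        (e.repr v 0 * p + e.repr v 1 * q) * (e.repr z.2 0 * q - e.repr z.2 1 * p)) • n := by
    rw [← hy]
    apply e.repr.injective
    ext i
    fin_cases i
    · simp [hn, flatNormal, ← hp, ← hq]
      ring
    · simp [hn, flatNormal, ← hp, ← hq]
      ring
  have h3 := congrArg (flatMetric f z n) hv
  rw [map_smul, map_smul, map_add, map_smul, map_smul, hny, h, smul_zero, smul_zero, add_zero, smul_eq_mul, smul_eq_mul] at h3
  have h4 : 2 * f z ≠ 0 := by positivity
  exact (mul_eq_zero.1 ((mul_eq_zero.1 h3).resolve_left hpq)).resolve_left h4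

/-- Let `μ > 0` be the minimum of `f` on a Euclidean unit circle, attained at `y₀`. By homogeneity
`f - μ |·|²` is nonnegative off the origin and zero at `y₀`, so the Hessian of `f` at `y₀` is at
least `2 μ |n|²` in each direction `n`. -/
lemma exists_flatMetric_pos (hdim : finrank ℝ E = 2) (hf : IsFlatEnergy T f) {x : E} (hx : x ∈ T)
    (hpos : ∀ y : E, y ≠ 0 → 0 < f (x, y)) :
    ∃ y : E, y ≠ 0 ∧ ∀ n, n ≠ 0 → 0 < flatMetric f (x, y) n n := by
  have : FiniteDimensional ℝ E := Module.finite_of_finrank_pos (by omega)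
  -- The norm of `E` need not be differentiable, so an auxiliary inner product is used.
  let i : E ≃L[ℝ] EuclideanSpace ℝ (Fin 2) := ContinuousLinearEquiv.ofFinrankEq (by rw [hdim]; simp)
  have hne : ∀ v ∈ Metric.sphere (0 : EuclideanSpace ℝ (Fin 2)) 1, i.symm v ≠ 0 := by
    intro v hv h0
    rw [i.symm.map_eq_zero_iff] at h0
    simp [h0] at hv
  have hcont : ContinuousOn (fun v => f (x, i.symm v)) (Metric.sphere (0 : EuclideanSpace ℝ (Fin 2)) 1) := by
    intro v hv
    have h1 : ContinuousAt f (x, i.symm v) := (hf.contDiffAt (x, i.symm v) hx (hne v hv)).continuousAt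
    have h2 : ContinuousAt (fun v => (x, i.symm v)) v := by fun_prop
    exact (ContinuousAt.comp (f := fun v => (x, i.symm v)) h1 h2).continuousWithinAt
  obtain ⟨v₀, hv₀, hmin⟩ := (isCompact_sphere (0 : EuclideanSpace ℝ (Fin 2)) 1).exists_isMinOn
    (NormedSpace.sphere_nonempty.2 zero_le_one) hcont
  set y₀ := i.symm v₀ with hy₀
  have hy₀' : y₀ ≠ 0 := hne v₀ hv₀
  have hiy₀ : i y₀ = v₀ := i.apply_symm_apply v₀
  set μ := f (x, y₀) with hμ
  have hμpos : 0 < μ := hpos y₀ hy₀'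
  have hbound : ∀ y, y ≠ 0 → μ * ‖i y‖ ^ 2 ≤ f (x, y) := by
    intro y hy
    have hiy : 0 < ‖i y‖ := norm_pos_iff.2 (by simpa using hy)
    have h1 : ‖i y‖⁻¹ • i y ∈ Metric.sphere (0 : EuclideanSpace ℝ (Fin 2)) 1 := by
      simp [norm_smul, hiy.ne']
    have h2 : μ ≤ f (x, i.symm (‖i y‖⁻¹ • i y)) := hmin h1
    rw [map_smul, i.symm_apply_apply] at h2
    have h3 := hf.homogeneous (x, y) hx ‖i y‖⁻¹ (by positivity)
    simp only at h3
    rw [h3] at h2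
    calc μ * ‖i y‖ ^ 2 ≤ (‖i y‖⁻¹ ^ 2 * f (x, y)) * ‖i y‖ ^ 2 := by gcongr
      _ = f (x, y) := by field_simp
  refine ⟨y₀, hy₀', fun n hn => ?_⟩
  let line : ℝ → E × E := fun t => (x, y₀ + t • n)
  have hline : ∀ t, HasDerivAt line (0, n) t := fun t => by
    have := (hasDerivAt_const t x).prodMk (((hasDerivAt_id t).smul_const n).const_add y₀)
    simpa using this
  have hl0 : line 0 = (x, y₀) := by simp [line]
  have hev : ∀ᶠ t in 𝓝 (0 : ℝ), y₀ + t • n ≠ 0 := by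
    have : ContinuousAt (fun t : ℝ => y₀ + t • n) 0 := by fun_prop
    exact this.eventually_ne (by simpa using hy₀')
  let P : ℝ → ℝ := fun t => ‖i y₀‖ ^ 2 + 2 * (t * inner ℝ (i y₀) (i n)) + t ^ 2 * ‖i n‖ ^ 2
  have hP : ∀ t, P t = ‖i (y₀ + t • n)‖ ^ 2 := fun t => by
    rw [map_add, map_smul, norm_add_sq_real, inner_smul_right, norm_smul, mul_pow, Real.norm_eq_abs, sq_abs]
  let D : ℝ → ℝ := fun t => f (line t) - μ * P t
  let D₁ : ℝ → ℝ := fun t => fderiv ℝ f (line t) (0, n) - μ * (2 * inner ℝ (i y₀) (i n) + 2 * t * ‖i n‖ ^ 2)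
  have hmin : IsLocalMin D 0 := by
    filter_upwards [hev] with t ht
    have h0 : D 0 = 0 := by
      simp only [D, hP, hl0, zero_smul, add_zero, hiy₀]
      rw [mem_sphere_zero_iff_norm.1 hv₀]
      simp [hμ]
    rw [h0]
    simp only [D, hP]
    exact sub_nonneg.2 (hbound _ ht)
  have hd1 : ∀ᶠ t in 𝓝 0, HasDerivAt D (D₁ t) t := by
    filter_upwards [hev] with t ht
    have h1 := ((hf.contDiffAt (line t) hx ht).differentiableAt (by simp)).hasFDerivAt.comp_hasDerivAt t (hline t)
    have h2 : HasDerivAt P (2 * inner ℝ (i y₀) (i n) + 2 * t * ‖i n‖ ^ 2) t := by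
      have := (((hasDerivAt_id t).mul_const (inner ℝ (i y₀) (i n))).const_mul 2).const_add (‖i y₀‖ ^ 2) |>.add
        ((hasDerivAt_pow 2 t).mul_const (‖i n‖ ^ 2))
      exact HasDerivAt.congr_deriv (f := P) this (by simp)
    exact h1.sub (h2.const_mul μ)
  have hd2 : HasDerivAt D₁ (flatMetric f (x, y₀) n n - μ * (2 * ‖i n‖ ^ 2)) 0 := by
    have h0 := ((hf.contDiffAt_fderiv (z := (x, y₀)) hx hy₀').differentiableAt (by simp)).hasFDerivAt
    rw [← hl0] at h0
    have h1 := (h0.comp_hasDerivAt (0 : ℝ) (hline 0)).clm_apply (hasDerivAt_const (0 : ℝ) ((0 : E), n))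
    have h2 := ((((hasDerivAt_id (0 : ℝ)).const_mul 2).mul_const (‖i n‖ ^ 2)).const_add (2 * inner ℝ (i y₀) (i n))).const_mul μ
    have h3 := h1.sub h2
    rw [flatMetric_apply, ← hl0]
    exact HasDerivAt.congr_deriv (f := D₁) h3 (by simp)
  have := nonneg_of_isLocalMin hmin hd1 hd2
  have hn' : 0 < ‖i n‖ := norm_pos_iff.2 (by simpa using hn)
  have : 0 < μ * (2 * ‖i n‖ ^ 2) := by positivity
  linarith

/-- A continuous function without zeros on the connected punctured plane keeps the sign that it has
at `y₀`. -/
lemma flatMetric_flatNormal_pos (hdim : finrank ℝ E = 2) (hf : IsFlatEnergy T f) {x : E} (hx : x ∈ T)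
    (hpos : ∀ y : E, y ≠ 0 → 0 < f (x, y)) {y : E} (hy : y ≠ 0) :
    0 < flatMetric f (x, y) (flatNormal e f (x, y)) (flatNormal e f (x, y)) := by
  have : FiniteDimensional ℝ E := Module.finite_of_finrank_pos (by omega)
  obtain ⟨y₀, hy₀, h₀⟩ := hf.exists_flatMetric_pos hdim hx hpos
  have hy₀pos := h₀ _ (hf.flatNormal_ne_zero (e := e) (z := (x, y₀)) hx hy₀ (hpos y₀ hy₀))
  let Φ : E → ℝ := fun y => flatMetric f (x, y) (flatNormal e f (x, y)) (flatNormal e f (x, y))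
  have hΦ : ∀ y, y ≠ 0 → Φ y ≠ 0 := fun y hy => hf.flatMetric_flatNormal_ne_zero (z := (x, y)) hx hy (hpos y hy)
  have hcont : ContinuousOn Φ {0}ᶜ := by
    intro y hy
    have hn := hf.contDiffAt_flatNormal (e := e) (z := (x, y)) hx hy
    have h1 : ContinuousAt (fun z => flatMetric f z (flatNormal e f z) (flatNormal e f z)) (x, y) :=
      (((hf.contDiffAt_flatMetric (z := (x, y)) hx hy).clm_apply hn).clm_apply hn).continuousAt
    have h2 : ContinuousAt (fun y : E => (x, y)) y := by fun_prop
    exact (ContinuousAt.comp (f := fun y : E => (x, y)) h1 h2).continuousWithinAt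
  have hconn : IsPreconnected ({0}ᶜ : Set E) := (isConnected_compl_singleton_of_one_lt_rank (by
    rw [← Module.finrank_eq_rank' , hdim]; norm_num) 0).isPreconnected
  by_contra! hneg
  obtain ⟨y', hy', h0⟩ := hconn.intermediate_value hy hy₀ hcont ⟨hneg, hy₀pos.le⟩
  exact hΦ y' hy' h0

end IsFlatEnergy
end PositiveDefinite

/-! ### Berwald frames and the Gauss curvature -/

section GaussCurvature
variable {E : Type*} [NormedAddCommGroup E] [NormedSpace ℝ E] [FiniteDimensional ℝ E]
  {M : Type*} [TopologicalSpace M] [T2Space M] [ChartedSpace E M] [IsManifold 𝓘(ℝ, E) ∞ M]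

attribute [local instance] isManifold_one

variable {F : TM E M → ℝ} {c : M} {u : TM E M}

lemma flatCurv_congr {V : Type*} [NormedAddCommGroup V] [NormedSpace ℝ V] {s s' : V × V → V} {z : V × V}
    (h : s =ᶠ[𝓝 z] s') : flatCurv s z = flatCurv s' z := by
  have h1 : flatConn s =ᶠ[𝓝 z] flatConn s' := by
    filter_upwards [h.fderiv (𝕜 := ℝ)] with y hy
    rw [flatConn, flatConn, hy]
  rw [flatCurv, flatCurv, flatHorDeriv, flatHorDeriv, h1.fderiv_eq, h1.eq_of_nhds]

namespace IsFinslerFunction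

lemma fderiv_energyRep (hF : IsFinslerFunction F) (hu : u ∈ slit E M) (h : u.proj ∈ (chartAt E c).source)
    (w : TangentSpace 𝓘(ℝ, E) u.proj) :
    fderiv ℝ (energyRep c F) (chart E c u) (0, baseRep c u.proj w) = F u * vDiff F u w := by
  have hd := (((contMDiffAt_iff_contDiffAt_chart h _).1 (hF.contMDiffAt hu)).differentiableAt (by simp)).hasFDerivAt
  have h1 := (hd.pow 2).const_mul (1 / 2)
  rw [vDiff, ContinuousLinearMap.comp_apply, dTM_eq h (hF.contMDiffAt hu), tmRep_iMap h]
  have h2 := congrArg (fun L : E × E →L[ℝ] ℝ => L (0, baseRep c u.proj w)) h1.fderiv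
  refine h2.trans ?_
  simp [chart_left_inv h]
  ring

/-- The trace of the curvature is proportional to the differential of the energy. -/
lemma trace_flatCurv_mul (hdim : finrank ℝ E = 2) (hF : IsFinslerFunction F) (hu : u ∈ slit E M)
    (h : u.proj ∈ (chartAt E c).source) (a : E) :
    LinearMap.trace ℝ E ((curvRep c (canonicalSpray F) u).flip a) * F u ^ 2 =
      tr (jacobi (canonicalSpray F)) u * fderiv ℝ (energyRep c F) (chart E c u) (0, a) := by
  have hz := mem_chart_target_iff'.1 (chart_mem_target h)
  have hz' := (mem_slit_iff h).1 hu
  have hE := hF.isFlatEnergy c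
  have h1 := two_dim_identity hdim (curvRep c (canonicalSpray F) u) (fun a => flatCurv_self _ _ a) a (chart E c u).2
  have h2 : fderiv ℝ (energyRep c F) (chart E c u) (0, curvRep c (canonicalSpray F) u a (chart E c u).2) = 0 := by
    rw [curvRep_apply, flatCurv_congr (hF.sprayCoeff_canonicalSpray hu h), hE.fderiv_flatCurv hz hz']
  have h3 := hE.fderiv_self hz hz'
  have h4 : energyRep c F (chart E c u) = 1 / 2 * F u ^ 2 := by rw [energyRep, chart_left_inv h, energy]
  -- Apply the fibre derivative of the energy to the plane identity: the curvature term vanishes by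
  -- `h2`, and Euler's relation turns the canonical vector into `F²`.
  have h5 := congrArg (fun v => (fderiv ℝ (energyRep c F) (chart E c u)).comp (ContinuousLinearMap.inr ℝ E E) v) h1
  simp only [map_add, map_sub, map_smul, map_zero, ContinuousLinearMap.comp_apply, ContinuousLinearMap.inr_apply, h2, h3, h4, smul_eq_mul] at h5
  rw [hF.isSpray.tr_jacobi hu h, ← curvRep_flip]
  linarith

lemma tr_curvature_eq (hdim : finrank ℝ E = 2) (hF : IsFinslerFunction F) (hpos : IsPositiveDefinite F) (hu : u ∈ slit E M)
    {X : Sec E M} (hX : SmoothSec (slit E M) X) :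
    tr (fun Z => curvature (canonicalSpray F) Z X) u = tr (jacobi (canonicalSpray F)) u / F u * vDiff F u (X u) := by
  have h := mem_chart_source E u.proj
  have h1 := hF.trace_flatCurv_mul hdim hu h (baseRep u.proj u.proj (X u))
  rw [hF.fderiv_energyRep hu h, curvRep_flip,
    ← hF.isSpray.tr_curvature hu h (SmoothSec.contDiffAt hX (slit_mem_nhds hu) h)] at h1
  have := (hpos u hu).ne'
  field_simp
  apply mul_left_cancel₀ this
  linarith

/-- In `R(m, δ) = (tr K) m - (tr R)(m) δ` the pairing with `m` kills the last term and normalizes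
the first; the factor `1 / F` comes from `ℓ`. The value does not involve `m`, so it is the same in
all frames. -/
lemma frameCurvature_eq (hdim : finrank ℝ E = 2) (hF : IsFinslerFunction F) (hpos : IsPositiveDefinite F)
    {U : Set (TM E M)} {m : Sec E M} (hm : IsBerwaldFrame F U m) (hu : u ∈ U) :
    frameCurvature F m u = tr (jacobi (canonicalSpray F)) u / F u := by
  have hu' := hm.subset hu
  have h := mem_chart_source E u.proj
  set c := u.proj with hc
  have hz := mem_chart_target_iff'.1 (chart_mem_target h)
  have hz' := (mem_slit_iff h).1 hu'
  have hE := hF.isFlatEnergy c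
  have hFne := (hpos u hu').ne'
  have hF' := (contMDiffAt_iff_contDiffAt_chart h _).1 (hF.contMDiffAt hu')
  have hℓ : ContDiffAt ℝ ∞ (secRep c (supportElement F)) (chart E c u) := by
    have h1 : ContDiffAt ℝ ∞ (fun z : E × E => (F ((chart E c).symm z))⁻¹ • z.2) (chart E c u) :=
      (hF'.inv (by rwa [chart_left_inv h])).smul contDiffAt_snd
    refine h1.congr_of_eventuallyEq ?_
    filter_upwards [(isOpen_chart_target c).mem_nhds (chart_mem_target h)] with z hz
    rw [secRep, supportElement, map_smul, baseRep_delta (chart_symm_mem hz), (chart E c).right_inv hz]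
  have hℓu : baseRep c u.proj (supportElement F u) = (F u)⁻¹ • (chart E c u).2 := by
    rw [supportElement, map_smul, baseRep_delta h]
  have hmd := SmoothSec.contDiffAt hm.smooth (hm.isOpen.mem_nhds hu) h
  have ho := hm.orthogonal u hu
  have hn := hm.unit u hu
  rw [hF.metric_eq hu' h, hℓu, map_smul, smul_apply, smul_eq_mul] at ho
  rw [hF.metric_eq hu' h] at hn
  have ho' := (mul_eq_zero.1 ho).resolve_left (inv_ne_zero hFne)
  rw [frameCurvature, hF.metric_eq hu' h, hF.isSpray.baseRep_curvature hu' h hmd hℓ, hℓu, map_smul, ← curvRep_apply]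
  have h1 := two_dim_identity hdim (curvRep c (canonicalSpray F) u) (fun a => flatCurv_self _ _ a) (baseRep c u.proj (m u)) (chart E c u).2
  rw [sub_add, sub_eq_zero] at h1
  rw [h1, map_smul, map_sub, map_smul, map_smul, smul_apply, sub_apply, smul_apply, smul_apply, hn, ho',
    hF.isSpray.tr_jacobi hu' h, ← curvRep_flip]
  simp only [smul_eq_mul]
  field_simp
  ring

/-- `flatNormal` divided by the square root of its squared length `Φ > 0`, over a whole chart
domain. -/
lemma exists_isBerwaldFrame (hdim : finrank ℝ E = 2) (hF : IsFinslerFunction F) (hpos : IsPositiveDefinite F)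
    (hu : u ∈ slit E M) : ∃ (U : Set (TM E M)) (m : Sec E M), IsBerwaldFrame F U m ∧ u ∈ U := by
  have h := mem_chart_source E u.proj
  set c := u.proj with hc
  let e : Basis (Fin 2) ℝ E := Module.finBasisOfFinrankEq ℝ E hdim
  have hE := hF.isFlatEnergy c
  let f := energyRep c F
  let n := flatNormal e f
  let Φ : E × E → ℝ := fun z => flatMetric f z (n z) (n z)
  have hfpos : ∀ z : E × E, z.1 ∈ (extChartAt 𝓘(ℝ, E) c).target → z.2 ≠ 0 → 0 < f z := by
    intro z hz hz'
    have := hpos _ ((chart_symm_mem_slit (mem_chart_target_iff'.2 hz)).2 hz')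
    simp only [f, energyRep, energy]
    positivity
  have hΦ : ∀ z : E × E, z.1 ∈ (extChartAt 𝓘(ℝ, E) c).target → z.2 ≠ 0 → 0 < Φ z := fun z hz hz' =>
    hE.flatMetric_flatNormal_pos (x := z.1) (y := z.2) hdim hz (fun y hy => hfpos (z.1, y) hz hy) hz'
  let m : Sec E M := fun v => (baseRep c v.proj).inverse ((Real.sqrt (Φ (chart E c v)))⁻¹ • n (chart E c v))
  let U : Set (TM E M) := (chart E c).source ∩ slit E M
  have hU : IsOpen U := (isOpen_chart_source c).inter (isOpen_slit E M)
  have hm : ∀ v : TM E M, v.proj ∈ (chartAt E c).source → baseRep c v.proj (m v) = (Real.sqrt (Φ (chart E c v)))⁻¹ • n (chart E c v) :=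
    fun v hv => (isInvertible_baseRep hv).self_apply_inverse _
  have hmem : ∀ v ∈ U, v.proj ∈ (chartAt E c).source := fun v hv => by
    have := hv.1
    rwa [chart_source] at this
  refine ⟨U, m, ⟨hU, inter_subset_right, fun v hv => ?_, fun v hv => ?_, fun v hv => ?_⟩, ⟨by rw [chart_source]; exact h, hu⟩⟩ <;>
  · have hv1 := hmem v hv
    have hz := mem_chart_target_iff'.1 (chart_mem_target hv1)
    have hz' := (mem_slit_iff hv1).1 hv.2
    have hpos' := hΦ _ hz hz'
    -- The three alternatives treat smoothness, orthogonality and normalization of `m`, in this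
    -- order.
    first
    | refine ContMDiffAt.contMDiffWithinAt ((contMDiffAt_sec_iff_secRep hv1 _).2 ?_)
      have hn := hE.contDiffAt_flatNormal (e := e) hz hz'
      have hΦd : ContDiffAt ℝ ∞ Φ (chart E c v) := ((hE.contDiffAt_flatMetric hz hz').clm_apply hn).clm_apply hn
      refine (((hΦd.sqrt hpos'.ne').inv (Real.sqrt_pos.2 hpos').ne').smul hn).congr_of_eventuallyEq ?_
      filter_upwards [(isOpen_chart_target c).mem_nhds (chart_mem_target hv1)] with z hz
      rw [secRep, hm _ (chart_symm_mem hz), (chart E c).right_inv hz]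
      rfl
    | rw [hF.metric_eq hv.2 hv1, hm v hv1, supportElement, map_smul (baseRep c v.proj), baseRep_delta hv1, map_smul, map_smul, smul_apply,
        hE.flatMetric_symm hz hz', hE.flatMetric_self hz hz', fderiv_flatNormal, smul_zero, smul_zero]
    | rw [hF.metric_eq hv.2 hv1, hm v hv1, map_smul, map_smul, smul_apply, smul_smul, ← mul_inv, Real.mul_self_sqrt hpos'.le]
      exact inv_mul_cancel₀ hpos'.ne'

/-- Since a frame exists, the number chosen in `gaussCurvature` is the curvature in some frame, and
all frames give the same value. -/
lemma gaussCurvature_eq (hdim : finrank ℝ E = 2) (hF : IsFinslerFunction F) (hpos : IsPositiveDefinite F)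
    (hu : u ∈ slit E M) : gaussCurvature F u = tr (jacobi (canonicalSpray F)) u / F u := by
  obtain ⟨U, m, hm, hu'⟩ := hF.exists_isBerwaldFrame hdim hpos hu
  obtain ⟨U', m', hm', hu'', h⟩ := Classical.epsilon_spec (p := fun k : ℝ => ∃ (U : Set (TM E M)) (m : Sec E M),
    IsBerwaldFrame F U m ∧ u ∈ U ∧ k = frameCurvature F m u) ⟨_, U, m, hm, hu', rfl⟩
  exact h.trans (hF.frameCurvature_eq hdim hpos hm' hu'')

end IsFinslerFunction
end GaussCurvature

end Finsler

end

theorem mainTheorem9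
    {E : Type*} [NormedAddCommGroup E] [NormedSpace ℝ E] [FiniteDimensional ℝ E]
    {M : Type*} [TopologicalSpace M] [T2Space M] [SecondCountableTopology M] [ConnectedSpace M]
    [ChartedSpace E M] [IsManifold 𝓘(ℝ, E) ∞ M]
    (hdim : Module.finrank ℝ E = 2)
    (F : Finsler.TM E M → ℝ) (hF : Finsler.IsFinslerFunction F) :
    (Finsler.IsPositiveDefinite F →
      -- the Gauss curvature is the same in all Berwald frames, and these exist around every point
      (∀ u ∈ Finsler.slit E M, ∃ (U : Set (Finsler.TM E M)) (m : Finsler.Sec E M),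
        Finsler.IsBerwaldFrame F U m ∧ u ∈ U) ∧
      (∀ (U : Set (Finsler.TM E M)) (m : Finsler.Sec E M), Finsler.IsBerwaldFrame F U m →
        ∀ u ∈ U, Finsler.frameCurvature F m u = Finsler.gaussCurvature F u) ∧
      -- the form of the Jacobi endomorphism
      ∀ X : Finsler.Sec E M, Finsler.SmoothSec (Finsler.slit E M) X → ∀ u ∈ Finsler.slit E M,
        Finsler.jacobi (Finsler.canonicalSpray F) X u =
          (Finsler.gaussCurvature F u * F u) • X u
            - (Finsler.gaussCurvature F u * Finsler.vDiff F u (X u)) • Finsler.delta u) ∧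
    Finsler.IsIsotropic (Finsler.canonicalSpray F) ∧
    ∀ X : Finsler.Sec E M, Finsler.SmoothSec (Finsler.slit E M) X → ∀ u ∈ Finsler.slit E M,
      Finsler.weyl (Finsler.canonicalSpray F) X u = 0 := by
  refine ⟨fun hpos => ⟨fun u hu => hF.exists_isBerwaldFrame hdim hpos hu, fun U m hm u hu => ?_,
    fun X hX u hu => ?_⟩, hF.isSpray.isIsotropic hdim, fun X hX u hu => hF.isSpray.weyl_eq_zero hdim hX hu⟩
  · rw [hF.frameCurvature_eq hdim hpos hm hu, hF.gaussCurvature_eq hdim hpos (hm.subset hu)]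
  · rw [hF.gaussCurvature_eq hdim hpos hu, div_mul_cancel₀ _ (hpos u hu).ne', hF.isSpray.jacobi_eq hdim hu hX,
      hF.tr_curvature_eq hdim hpos hu hX]
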